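/- Let $(\xi_i)_{i\ge 1}$ be integer-valued i.i.d. random variables with $\mathbf E|\xi_1|<\infty$ and $\mathbf E e^{\gamma\xi_1}<\infty$ for all $\gamma>0$, whose distribution has maximal span one, i.e. it is not concentrated on any arithmetic progression $b+d\mathbb Z$ with $b\in\mathbb Z$ and an integer $d\ge 2$. Let $\omega=\sup\{m\in\mathbb Z:\mathbf P(\xi_1=m)>0\}\le\infty$ and assume that either $\omega=\infty$, or $\omega<\infty$ and $\mathbf P(\xi_1=\omega)<1/2$. Let $S_n=\xi_1+\dots+\xi_n$, let $M_n$ be the maximum of $2^n$ independent copies of $S_n$, and let $L(\gamma)=\ln\mathbf E e^{\gamma\xi_1}$. Then the equation $L(\gamma)-\gamma L'(\gamma)=\ln(1/2)$ has exactly one solution $\gamma_*$ in $(0,\infty)$. Put $\rho_*=L'(\gamma_*)$ and $\sigma(\gamma_*)=\sqrt{L''(\gamma_*)}$; then $\sigma(\gamma_*)>0$, and for every bounded set $I\subset\mathbb R$, as $n\to\infty$, $$\mathbf P\Big\{M_n<\rho_* n-\frac{\ln n}{2\gamma_*}+z\Big\}=\exp\Big\{-\frac{e^{-\gamma_* z}(1+o(1))}{\sqrt{2\pi}\,\sigma(\gamma_*)(1-e^{-\gamma_*})}\Big\}$$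 uniformly over those $z\in I$ for which $\rho_* n-\frac{\ln n}{2\gamma_*}+z$ is an integer. Consequently the law of $M_n$ follows a discrete Gumbel-type helix: if $F^a$ ($a\in\mathbb R$) is the distribution on $\mathbb Z$ with $F^a((-\infty,m))=\exp\{-e^{-\gamma_*(m-a)}\}$ for $m\in\mathbb Z$, and $a_n=\rho_* n-\frac1{\gamma_*}\ln\big[\sqrt{2\pi n}\,\sigma(\gamma_*)(1-e^{-\gamma_*})\big]$, then $$\sup_{m\in\mathbb Z}\big|\mathbf P\{M_n<m\}-F^{a_n}((-\infty,m))\big|\to 0\qquad(n\to\infty).$$ -/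

import Mathlib

open MeasureTheory ProbabilityTheory Filter Topology

namespace CyclicMaxima

noncomputable section

/-- The cumulant `L(γ) = ln E exp(γ X)` of an integer-valued random variable `X`. -/
def cumulant {Ω : Type*} [MeasurableSpace Ω] (μ : Measure Ω) (X : Ω → ℤ) (γ : ℝ) : ℝ :=
  cgf (fun w => (X w : ℝ)) μ γ

/-- `σ(γ)`, the positive square root of `L''(γ)`. -/
def sigma {Ω : Type*} [MeasurableSpace Ω] (μ : Measure Ω) (X : Ω → ℤ) (γ : ℝ) : ℝ :=
  Real.sqrt (iteratedDeriv 2 (cumulant μ X) γ)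

/-- The equation `L(γ) - γ L'(γ) = ln (1/2)` together with `γ > 0`. -/
def IsCriticalExponent {Ω : Type*} [MeasurableSpace Ω] (μ : Measure Ω) (X : Ω → ℤ)
    (γ : ℝ) : Prop :=
  0 < γ ∧ cumulant μ X γ - γ * deriv (cumulant μ X) γ = Real.log (1 / 2)

/-- The upper endpoint `ω = sup {m : P(X = m) > 0}` of the distribution of `X`, in `[-∞, ∞]`. -/
def upperEndpoint {Ω : Type*} [MeasurableSpace Ω] (μ : Measure Ω) (X : Ω → ℤ) : EReal :=
  sSup {x : EReal | ∃ m : ℤ, x = ((m : ℝ) : EReal) ∧ 0 < μ {w | X w = m}}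

/-- The distribution of `X` has maximal span one: it is not concentrated on any arithmetic
progression `b + d ℤ` with `d ≥ 2`. -/
def HasSpanOne {Ω : Type*} [MeasurableSpace Ω] (μ : Measure Ω) (X : Ω → ℤ) : Prop :=
  ∀ d : ℕ, 2 ≤ d → ∀ b : ℤ, ¬ ∀ᵐ w ∂μ, (d : ℤ) ∣ X w - b

/-- The partial sum of the first `n` variables. -/
def partialSum {Ω : Type*} (ξ : ℕ → Ω → ℤ) (n : ℕ) (w : Ω) : ℤ :=
  ∑ i ∈ Finset.range n, ξ i w

/-- The maximum of `2 ^ n` random variables. -/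
def maxCopies {Ω : Type*} {n : ℕ} (S : Fin (2 ^ n) → Ω → ℤ) (w : Ω) : ℤ :=
  Finset.univ.sup' Finset.univ_nonempty (fun j => S j w)

/-- The Gumbel-type distribution function `m ↦ exp (- exp (- γ (m - a)))` on the integers. -/
def gumbelCDF (γ a : ℝ) (m : ℤ) : ℝ :=
  Real.exp (-Real.exp (-γ * ((m : ℝ) - a)))

/-- The discrete Gumbel-type distribution `F^a` on the integers, which gives mass
`G(m + 1) - G(m)` to the point `m`, where `G(m) = exp (- exp (- γ (m - a)))`. -/
def helix (γ a : ℝ) : Measure ℤ :=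
  Measure.sum fun m : ℤ => ENNReal.ofReal (gumbelCDF γ a (m + 1) - gumbelCDF γ a m) •
    Measure.dirac m

theorem helix_singleton (γ a : ℝ) (m : ℤ) :
    helix γ a {m} = ENNReal.ofReal (gumbelCDF γ a (m + 1) - gumbelCDF γ a m) := by
  rw [helix, Measure.sum_apply _ (measurableSet_singleton m), tsum_eq_single m]
  · simp
  · intro k hk
    simp [hk]

theorem gumbelCDF_mono {γ : ℝ} (hγ : 0 < γ) (a : ℝ) : Monotone (gumbelCDF γ a) := by
  intro m k hmk
  have h : (m : ℝ) ≤ k := by exact_mod_cast hmk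
  unfold gumbelCDF
  apply Real.exp_le_exp.mpr
  apply neg_le_neg
  apply Real.exp_le_exp.mpr
  nlinarith

theorem helix_Ico {γ : ℝ} (hγ : 0 < γ) (a : ℝ) (m : ℤ) (n : ℕ) :
    helix γ a (Set.Ico (m - n) m) =
      ENNReal.ofReal (gumbelCDF γ a m - gumbelCDF γ a (m - n)) := by
  induction n with
  | zero => simp
  | succ n ih =>
    have h1 : Set.Ico (m - ((n + 1 : ℕ) : ℤ)) m
        = {m - ((n + 1 : ℕ) : ℤ)} ∪ Set.Ico (m - n) m := by
      ext x; simp only [Set.mem_Ico, Set.mem_union, Set.mem_singleton_iff]; push_cast; omega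
    have h2 : m - ((n + 1 : ℕ) : ℤ) + 1 = m - n := by push_cast; ring
    rw [h1, measure_union _ measurableSet_Ico, ih, helix_singleton, h2, ← ENNReal.ofReal_add]
    · congr 1; ring
    · exact sub_nonneg.mpr (gumbelCDF_mono hγ a (by push_cast; omega))
    · exact sub_nonneg.mpr (gumbelCDF_mono hγ a (by omega))
    · rw [Set.disjoint_singleton_left, Set.mem_Ico]; push_cast; omega

/-- The defining relation `F^a((-∞, m)) = exp (- exp (- γ (m - a)))`. -/
theorem helix_Iio {γ : ℝ} (hγ : 0 < γ) (a : ℝ) (m : ℤ) :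
    helix γ a (Set.Iio m) = ENNReal.ofReal (gumbelCDF γ a m) := by
  have hU : Set.Iio m = ⋃ n : ℕ, Set.Ico (m - n) m := by
    ext x
    simp only [Set.mem_Iio, Set.mem_iUnion, Set.mem_Ico]
    exact ⟨fun h => ⟨(m - x).toNat, by omega⟩, fun ⟨n, h⟩ => h.2⟩
  have hmono : Monotone fun n : ℕ => Set.Ico (m - n) m := by
    intro i j hij x hx
    simp only [Set.mem_Ico] at hx ⊢
    omega
  have h1 := tendsto_measure_iUnion_atTop (μ := helix γ a) hmono
  rw [← hU] at h1
  refine tendsto_nhds_unique h1 ?_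
  have h2 : Tendsto (fun n : ℕ => gumbelCDF γ a (m - n)) atTop (𝓝 0) := by
    unfold gumbelCDF
    apply Real.tendsto_exp_atBot.comp
    apply tendsto_neg_atTop_atBot.comp
    apply Real.tendsto_exp_atTop.comp
    have h3 : (fun n : ℕ => -γ * (((m - n : ℤ) : ℝ) - a))
        = fun n : ℕ => -γ * ((m : ℝ) - a) + γ * (n : ℝ) := by
      funext n; push_cast; ring
    rw [h3]
    exact tendsto_atTop_add_const_left _ _ (tendsto_natCast_atTop_atTop.const_mul_atTop hγ)
  have h4 := ENNReal.tendsto_ofReal (h2.const_sub (gumbelCDF γ a m))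
  rw [sub_zero] at h4
  exact h4.congr fun n => (helix_Ico hγ a m n).symm

end

end CyclicMaxima

/-! The threshold sits where the tail of S_n is of order 2^{-n}. The function L(γ) - γL'(γ) has
derivative -γL''(γ) < 0, since L'' is the variance of ξ under the tilted law and span one excludes
constants. It exceeds ln(1/2) near 0 because L(0+) = 0; the condition at the upper endpoint forces
it below ln(1/2) somewhere. Hence there is exactly one critical exponent
(`existsUnique_isCriticalExponent`).

The analytic core is a precise large deviation estimate, `eventually_measure_ge_partialSum`: 2^n
P(S_n ≥ k) ~ e^{-γz}/(√(2π) σ (1 - e^{-γ})) for k = ρn - ln n/(2γ) + z, uniformly over bounded z.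
Expanding 1/(1 - e^{-(γ+it)}) as a geometric series writes the tail as one Fourier integral over
[-π, π] along the line of real part γ (`measure_ge_eq_integral`); independence and tilting turn its
integrand into an n-th power of a normalised characteristic function (`measure_ge_partialSum_eq`).
On the scale t = s/(σ√n) the power tends to e^{-s²/2}, and span one supplies a Gaussian majorant on
the whole window (`exists_norm_normCharFun_le`), so dominated convergence applies.

For the maximum, P(M_n < k) = (1 - p)^{2^n} with p = P(S_n ≥ k) of order 2^{-n}, so the power is
exp(-2^n p(1 + o(1))). The shift a_n absorbs √n and the constants; closeness on a bounded window
then spreads to all integers by monotonicity. -/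

namespace CyclicMaxima

/-! ### Convexity of the cumulant and its tangent intercept near zero -/

section CriticalExponent

variable {Ω : Type*} [MeasurableSpace Ω] {μ : Measure Ω} {X : Ω → ℤ}

theorem mem_interior_integrableExpSet
    (h_exp : ∀ γ : ℝ, 0 < γ → Integrable (fun w => Real.exp (γ * (X w : ℝ))) μ)
    {γ : ℝ} (hγ : 0 < γ) : γ ∈ interior (integrableExpSet (fun w => (X w : ℝ)) μ) :=
  mem_interior.mpr ⟨Set.Ioi 0, fun t ht => h_exp t ht, isOpen_Ioi, hγ⟩

theorem HasSpanOne.not_ae_eq (h_span : HasSpanOne μ X) (b : ℤ) : ¬ ∀ᵐ w ∂μ, X w = b := fun h =>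
  h_span 2 le_rfl b (h.mono fun w hw => by simp [hw])

/-- L'' is the variance under the tilted law. If it vanished, X would be constant almost surely
under that law, hence under μ by mutual absolute continuity, against span one. -/
theorem iteratedDeriv_two_cumulant_pos [IsProbabilityMeasure μ]
    (h_exp : ∀ γ : ℝ, 0 < γ → Integrable (fun w => Real.exp (γ * (X w : ℝ))) μ)
    (h_span : HasSpanOne μ X) {γ : ℝ} (hγ : 0 < γ) :
    0 < iteratedDeriv 2 (cumulant μ X) γ := by
  have hmem := mem_interior_integrableExpSet h_exp hγ
  have hv := variance_tilted_mul hmem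
  have : IsProbabilityMeasure (μ.tilted (fun w => γ * (X w : ℝ))) :=
    isProbabilityMeasure_tilted (h_exp γ hγ)
  change 0 < iteratedDeriv 2 (cgf (fun w => (X w : ℝ)) μ) γ
  rw [← hv]
  refine lt_of_le_of_ne (variance_nonneg _ _) fun h0 => ?_
  have hae := ae_eq_integral_of_variance_eq_zero (memLp_tilted_mul hmem 2) h0.symm
  have hae' : ∀ᵐ w ∂μ, (X w : ℝ) = _ := (absolutelyContinuous_tilted (h_exp γ hγ)).ae_le hae
  obtain ⟨w₀, hw₀⟩ := hae'.exists
  refine h_span.not_ae_eq (X w₀) (hae'.mono fun w hw => ?_)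
  have : (X w : ℝ) = X w₀ := hw.trans hw₀.symm
  exact_mod_cast this

theorem analyticAt_cumulant
    (h_exp : ∀ γ : ℝ, 0 < γ → Integrable (fun w => Real.exp (γ * (X w : ℝ))) μ)
    {γ : ℝ} (hγ : 0 < γ) : AnalyticAt ℝ (cumulant μ X) γ :=
  analyticAt_cgf (mem_interior_integrableExpSet h_exp hγ)

theorem hasDerivAt_deriv_cumulant
    (h_exp : ∀ γ : ℝ, 0 < γ → Integrable (fun w => Real.exp (γ * (X w : ℝ))) μ)
    {γ : ℝ} (hγ : 0 < γ) :
    HasDerivAt (deriv (cumulant μ X)) (iteratedDeriv 2 (cumulant μ X) γ) γ := by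
  rw [iteratedDeriv_succ, iteratedDeriv_one]
  exact (analyticAt_cumulant h_exp hγ).deriv.differentiableAt.hasDerivAt

/-- The intercept at zero of the tangent of the cumulant has derivative `-γ L''(γ)`. -/
theorem hasDerivAt_tangent_intercept
    (h_exp : ∀ γ : ℝ, 0 < γ → Integrable (fun w => Real.exp (γ * (X w : ℝ))) μ)
    {γ : ℝ} (hγ : 0 < γ) :
    HasDerivAt (fun t => cumulant μ X t - t * deriv (cumulant μ X) t)
      (-(γ * iteratedDeriv 2 (cumulant μ X) γ)) γ := by
  have h := (analyticAt_cumulant h_exp hγ).differentiableAt.hasDerivAt.sub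
    ((hasDerivAt_id γ).mul (hasDerivAt_deriv_cumulant h_exp hγ))
  refine h.congr_deriv ?_
  simp

theorem strictAntiOn_tangent_intercept [IsProbabilityMeasure μ]
    (h_exp : ∀ γ : ℝ, 0 < γ → Integrable (fun w => Real.exp (γ * (X w : ℝ))) μ)
    (h_span : HasSpanOne μ X) :
    StrictAntiOn (fun t => cumulant μ X t - t * deriv (cumulant μ X) t) (Set.Ioi 0) := by
  refine strictAntiOn_of_deriv_neg (convex_Ioi 0)
    (fun t ht => (hasDerivAt_tangent_intercept h_exp ht).continuousAt.continuousWithinAt)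
    fun t ht => ?_
  rw [interior_Ioi] at ht
  rw [(hasDerivAt_tangent_intercept h_exp ht).deriv, neg_lt_zero]
  exact mul_pos ht (iteratedDeriv_two_cumulant_pos h_exp h_span ht)

theorem strictMonoOn_deriv_cumulant [IsProbabilityMeasure μ]
    (h_exp : ∀ γ : ℝ, 0 < γ → Integrable (fun w => Real.exp (γ * (X w : ℝ))) μ)
    (h_span : HasSpanOne μ X) : StrictMonoOn (deriv (cumulant μ X)) (Set.Ioi 0) := by
  refine strictMonoOn_of_deriv_pos (convex_Ioi 0)
    (fun t ht => (hasDerivAt_deriv_cumulant h_exp ht).continuousAt.continuousWithinAt)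
    fun t ht => ?_
  rw [interior_Ioi] at ht
  rw [(hasDerivAt_deriv_cumulant h_exp ht).deriv]
  exact iteratedDeriv_two_cumulant_pos h_exp h_span ht

/-- The mean value theorem on [γ, 2γ] and monotonicity of L' trade the derivative for values of L,
so that L(0+) = 0 suffices to control the intercept near zero. -/
theorem tangent_intercept_ge [IsProbabilityMeasure μ]
    (h_exp : ∀ γ : ℝ, 0 < γ → Integrable (fun w => Real.exp (γ * (X w : ℝ))) μ)
    (h_span : HasSpanOne μ X) {γ : ℝ} (hγ : 0 < γ) :
    2 * cumulant μ X γ - cumulant μ X (2 * γ) ≤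
      cumulant μ X γ - γ * deriv (cumulant μ X) γ := by
  have hlt : γ < 2 * γ := by linarith
  obtain ⟨c, hc, hc'⟩ := exists_deriv_eq_slope (cumulant μ X) hlt
    (fun t ht => (analyticAt_cumulant h_exp (hγ.trans_le ht.1)).continuousAt.continuousWithinAt)
    (fun t ht => (analyticAt_cumulant h_exp
      (hγ.trans ht.1)).differentiableAt.differentiableWithinAt)
  have hmono := strictMonoOn_deriv_cumulant h_exp h_span (Set.mem_Ioi.mpr hγ)
    (Set.mem_Ioi.mpr (hγ.trans hc.1)) hc.1
  have h2 : 2 * γ - γ = γ := by ring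
  rw [h2, eq_div_iff hγ.ne'] at hc'
  nlinarith

theorem tendsto_cumulant_zero [IsProbabilityMeasure μ] (hX : Measurable X)
    (h_exp : ∀ γ : ℝ, 0 < γ → Integrable (fun w => Real.exp (γ * (X w : ℝ))) μ) :
    Tendsto (cumulant μ X) (𝓝[>] 0) (𝓝 0) := by
  have hm : Tendsto (mgf (fun w => (X w : ℝ)) μ) (𝓝[>] 0) (𝓝 1) := by
    have h1 : ∫ w, (1 : ℝ) ∂μ = 1 := by simp
    rw [← h1]
    refine tendsto_integral_filter_of_dominated_convergence
      (fun w => 1 + Real.exp (1 * (X w : ℝ))) ?_ ?_ ((integrable_const _).add (h_exp 1 one_pos)) ?_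
    · exact Eventually.of_forall fun t => by fun_prop
    · filter_upwards [Ioo_mem_nhdsGT (zero_lt_one' ℝ)] with t ht
      refine Eventually.of_forall fun w => ?_
      rw [Real.norm_of_nonneg (Real.exp_pos _).le]
      rcases le_total 0 (X w : ℝ) with h | h
      · have : Real.exp (t * X w) ≤ Real.exp (1 * X w) :=
          Real.exp_le_exp.mpr (mul_le_mul_of_nonneg_right ht.2.le h)
        linarith
      · have : Real.exp (t * X w) ≤ 1 :=
          Real.exp_le_one_iff.mpr (mul_nonpos_of_nonneg_of_nonpos ht.1.le h)
        have := Real.exp_pos (1 * (X w : ℝ))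
        linarith
    · refine Eventually.of_forall fun w => ?_
      have : Tendsto (fun t : ℝ => Real.exp (t * X w)) (𝓝 0) (𝓝 (Real.exp (0 * X w))) :=
        Continuous.tendsto (by fun_prop) 0
      rw [zero_mul, Real.exp_zero] at this
      exact this.mono_left nhdsWithin_le_nhds
  have := hm.log one_ne_zero
  rwa [Real.log_one] at this

theorem exists_lt_tangent_intercept [IsProbabilityMeasure μ] (hX : Measurable X)
    (h_exp : ∀ γ : ℝ, 0 < γ → Integrable (fun w => Real.exp (γ * (X w : ℝ))) μ)
    (h_span : HasSpanOne μ X) {c : ℝ} (hc : c < 0) :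
    ∃ γ, 0 < γ ∧ c < cumulant μ X γ - γ * deriv (cumulant μ X) γ := by
  have h1 := tendsto_cumulant_zero hX h_exp
  have h2 : Tendsto (fun t : ℝ => 2 * t) (𝓝[>] 0) (𝓝[>] 0) := by
    refine tendsto_nhdsWithin_iff.mpr ⟨?_, ?_⟩
    · have : Tendsto (fun t : ℝ => 2 * t) (𝓝 0) (𝓝 (2 * 0)) := Continuous.tendsto (by fun_prop) 0
      rw [mul_zero] at this
      exact this.mono_left nhdsWithin_le_nhds
    · filter_upwards [self_mem_nhdsWithin] with t ht
      exact Set.mem_Ioi.mpr (mul_pos two_pos (Set.mem_Ioi.mp ht))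
  have h3 := (h1.const_mul 2).sub (h1.comp h2)
  rw [mul_zero, sub_zero] at h3
  obtain ⟨γ, hγ, hpos⟩ := ((h3.eventually (lt_mem_nhds hc)).and self_mem_nhdsWithin).exists
  exact ⟨γ, hpos, hγ.trans_le (tangent_intercept_ge h_exp h_span hpos)⟩

end CriticalExponent

/-! ### Existence of the critical exponent from the condition at the upper endpoint -/

section UpperEndpoint

variable {Ω : Type*} [MeasurableSpace Ω] {μ : Measure Ω} {X : Ω → ℤ}

/-- The quotient (L(t) - tm - c)/t has derivative (c - intercept)/t² ≤ 0, so it decreases. By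
Chernoff it is at least (ln P(X ≥ m) - c)/t, which tends to 0; hence it is nonnegative throughout.
-/
theorem le_cumulant_of_le_tangent_intercept [IsProbabilityMeasure μ]
    (h_exp : ∀ γ : ℝ, 0 < γ → Integrable (fun w => Real.exp (γ * (X w : ℝ))) μ) {c : ℝ}
    (hc : ∀ γ, 0 < γ → c ≤ cumulant μ X γ - γ * deriv (cumulant μ X) γ) {m : ℤ}
    (hm : 0 < μ {w | X w = m}) {γ : ℝ} (hγ : 0 < γ) : γ * m + c ≤ cumulant μ X γ := by
  have hderiv : ∀ t : ℝ, 0 < t → HasDerivAt (fun t => (cumulant μ X t - t * m - c) / t)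
      ((c - (cumulant μ X t - t * deriv (cumulant μ X) t)) / t ^ 2) t := fun t ht => by
    have h := ((((analyticAt_cumulant h_exp ht).differentiableAt.hasDerivAt.sub
      ((hasDerivAt_id t).mul_const (m : ℝ))).sub_const c).div (hasDerivAt_id t) ht.ne')
    refine h.congr_deriv ?_
    simp only [id, Pi.sub_apply]
    ring
  have hanti : AntitoneOn (fun t => (cumulant μ X t - t * m - c) / t) (Set.Ioi 0) := by
    refine antitoneOn_of_deriv_nonpos (convex_Ioi 0)
      (fun t ht => (hderiv t ht).continuousAt.continuousWithinAt) ?_ ?_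
    · rw [interior_Ioi]
      exact fun t ht => (hderiv t ht).differentiableAt.differentiableWithinAt
    · rw [interior_Ioi]
      intro t ht
      rw [(hderiv t ht).deriv]
      exact div_nonpos_of_nonpos_of_nonneg (sub_nonpos.mpr (hc t ht)) (sq_nonneg t)
  have hq : 0 < μ.real {w | (m : ℝ) ≤ X w} := by
    refine ENNReal.toReal_pos (hm.trans_le (measure_mono fun w hw => ?_)).ne' (measure_ne_top _ _)
    have hw' : X w = m := hw
    simp [hw']
  have hlower : ∀ t : ℝ, 0 < t →
      Real.log (μ.real {w | (m : ℝ) ≤ X w}) ≤ cumulant μ X t - t * m := fun t ht => by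
    have h := measure_ge_le_exp_cgf (X := fun w => (X w : ℝ)) (m : ℝ) ht.le (h_exp t ht)
    have h' := Real.log_le_log hq h
    rw [Real.log_exp] at h'
    unfold cumulant
    linarith
  have hlim : Tendsto (fun t : ℝ => (Real.log (μ.real {w | (m : ℝ) ≤ X w}) - c) / t) atTop (𝓝 0) :=
    tendsto_const_nhds.div_atTop tendsto_id
  have h0 : 0 ≤ (cumulant μ X γ - γ * m - c) / γ := by
    refine le_of_tendsto hlim ?_
    filter_upwards [eventually_ge_atTop γ] with t ht
    have ht0 := hγ.trans_le ht
    refine le_trans ?_ (hanti hγ ht0 ht)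
    exact div_le_div_of_nonneg_right (sub_le_sub_right (hlower t ht0) c) ht0.le
  rw [le_div_iff₀ hγ, zero_mul] at h0
  linarith

theorem exists_measure_pos [IsProbabilityMeasure μ] : ∃ m : ℤ, 0 < μ {w | X w = m} := by
  by_contra! h
  have h0 : ∀ m : ℤ, ∀ᵐ w ∂μ, X w ≠ m := fun m => by
    simpa [ae_iff] using le_antisymm (h m) zero_le
  obtain ⟨w, hw⟩ := (ae_all_iff.mpr h0).exists
  exact hw (X w) rfl

theorem tendsto_integral_exp_mul_sub [IsProbabilityMeasure μ] (hX : Measurable X) {m : ℤ}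
    (hm : ∀ᵐ w ∂μ, X w ≤ m) :
    Tendsto (fun t : ℝ => ∫ w, Real.exp (t * (X w - m)) ∂μ) atTop
      (𝓝 (μ.real {w | X w = m})) := by
  have hmeas : MeasurableSet {w | X w = m} := hX (measurableSet_singleton m)
  rw [← integral_indicator_one hmeas]
  refine tendsto_integral_filter_of_dominated_convergence (fun _ => 1) ?_ ?_
    (integrable_const _) ?_
  · exact Eventually.of_forall fun t => by fun_prop
  · filter_upwards [eventually_ge_atTop 0] with t ht
    filter_upwards [hm] with w hw
    have : (X w : ℝ) ≤ m := by exact_mod_cast hw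
    rw [Real.norm_of_nonneg (Real.exp_pos _).le, Real.exp_le_one_iff]
    exact mul_nonpos_of_nonneg_of_nonpos ht (by linarith)
  · filter_upwards [hm] with w hw
    rcases hw.eq_or_lt with h | h
    · have : w ∈ {w | X w = m} := h
      simp [this, h]
    · have : w ∉ {w | X w = m} := h.ne
      rw [Set.indicator_of_notMem this]
      have h' : (X w : ℝ) - m < 0 := by
        have : (X w : ℝ) < m := by exact_mod_cast h
        linarith
      exact Real.tendsto_exp_atBot.comp (tendsto_id.atTop_mul_const_of_neg h')

/-- Otherwise γm + ln(1/2) ≤ L(γ) for every atom m and every γ > 0. For ω = ∞, an atom beyond L(1) -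
ln(1/2) contradicts this at γ = 1. For ω finite, m = ω gives E e^{t(X-ω)} ≥ 1/2, and t → ∞ yields
P(X = ω) ≥ 1/2. -/
theorem exists_tangent_intercept_lt [IsProbabilityMeasure μ] (hX : Measurable X)
    (h_exp : ∀ γ : ℝ, 0 < γ → Integrable (fun w => Real.exp (γ * (X w : ℝ))) μ)
    (h_end : upperEndpoint μ X = ⊤ ∨ (upperEndpoint μ X < ⊤ ∧
      μ {w | ((X w : ℝ) : EReal) = upperEndpoint μ X} < 1 / 2)) :
    ∃ γ, 0 < γ ∧ cumulant μ X γ - γ * deriv (cumulant μ X) γ < Real.log (1 / 2) := by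
  by_contra! hc
  rcases h_end with htop | ⟨hlt, hhalf⟩
  · have h1 : ((cumulant μ X 1 - Real.log (1 / 2) : ℝ) : EReal) < upperEndpoint μ X := by
      rw [htop]; exact EReal.coe_lt_top _
    obtain ⟨_, ⟨m, rfl, hm⟩, hlt⟩ := lt_sSup_iff.mp h1
    have h2 := le_cumulant_of_le_tangent_intercept h_exp hc hm one_pos
    rw [EReal.coe_lt_coe_iff] at hlt
    linarith
  · have hle : ∀ m : ℤ, 0 < μ {w | X w = m} → ((m : ℝ) : EReal) ≤ upperEndpoint μ X :=
      fun m hm => le_sSup ⟨m, rfl, hm⟩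
    obtain ⟨m₀, hm₀⟩ := exists_measure_pos (μ := μ) (X := X)
    have hbdd : ∃ b : ℤ, ∀ m : ℤ, 0 < μ {w | X w = m} → m ≤ b := by
      -- The endpoint is not ⊥ because some atom lies below it.
      obtain ⟨u, hu⟩ : ∃ u : ℝ, upperEndpoint μ X = u := by
        refine ⟨_, (EReal.coe_toReal hlt.ne fun h => ?_).symm⟩
        have := hle m₀ hm₀
        rw [h, le_bot_iff] at this
        exact EReal.coe_ne_bot _ this
      refine ⟨⌈u⌉, fun m hm => ?_⟩
      have := hle m hm
      rw [hu, EReal.coe_le_coe_iff] at this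
      exact_mod_cast this.trans (Int.le_ceil u)
    obtain ⟨m, hm, hmax⟩ := Int.exists_greatest_of_bdd hbdd ⟨m₀, hm₀⟩
    have hsup : upperEndpoint μ X = ((m : ℝ) : EReal) := by
      refine le_antisymm (sSup_le ?_) (hle m hm)
      rintro _ ⟨k, rfl, hk⟩
      exact_mod_cast hmax k hk
    have hae : ∀ᵐ w ∂μ, X w ≤ m := by
      have h0 : ∀ k : ℤ, ∀ᵐ w ∂μ, m < k → X w ≠ k := fun k => by
        by_cases hk : m < k
        · have : μ {w | X w = k} = 0 := by
            by_contra h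
            exact absurd (hmax k (pos_iff_ne_zero.mpr h)) (not_le.mpr hk)
          have h' : ∀ᵐ w ∂μ, X w ≠ k := by simpa [ae_iff] using this
          exact h'.mono fun w hw _ => hw
        · exact Eventually.of_forall fun w h => absurd h hk
      filter_upwards [ae_all_iff.mpr h0] with w hw
      by_contra h
      exact hw (X w) (not_le.mp h) rfl
    have hge : 1 / 2 ≤ μ.real {w | X w = m} := by
      refine ge_of_tendsto (tendsto_integral_exp_mul_sub hX hae) ?_
      filter_upwards [eventually_gt_atTop 0] with t ht
      have h1 := le_cumulant_of_le_tangent_intercept h_exp hc hm ht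
      have h2 : ∫ w, Real.exp (t * (X w - m)) ∂μ =
          Real.exp (-(t * m)) * mgf (fun w => (X w : ℝ)) μ t := by
        rw [mgf, ← integral_const_mul]
        refine integral_congr_ae (Eventually.of_forall fun w => ?_)
        simp only [← Real.exp_add]
        congr 1; ring
      have h3 : mgf (fun w => (X w : ℝ)) μ t = Real.exp (cumulant μ X t) :=
        (exp_cgf (h_exp t ht)).symm
      rw [h2, h3, ← Real.exp_add, ← Real.exp_log (one_half_pos (α := ℝ)), Real.exp_le_exp]
      linarith
    have hset : {w | ((X w : ℝ) : EReal) = upperEndpoint μ X} = {w | X w = m} := by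
      ext w
      simp [hsup]
    rw [hset] at hhalf
    have : μ.real {w | X w = m} < 1 / 2 := by
      have := (ENNReal.toReal_lt_toReal (measure_ne_top _ _) (by simp)).mpr hhalf
      simpa [Measure.real] using this
    linarith

theorem existsUnique_isCriticalExponent [IsProbabilityMeasure μ] (hX : Measurable X)
    (h_exp : ∀ γ : ℝ, 0 < γ → Integrable (fun w => Real.exp (γ * (X w : ℝ))) μ)
    (h_span : HasSpanOne μ X)
    (h_end : upperEndpoint μ X = ⊤ ∨ (upperEndpoint μ X < ⊤ ∧
      μ {w | ((X w : ℝ) : EReal) = upperEndpoint μ X} < 1 / 2)) :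
    ∃! γ : ℝ, IsCriticalExponent μ X γ := by
  have hanti := strictAntiOn_tangent_intercept h_exp h_span
  obtain ⟨a, ha, ha'⟩ := exists_lt_tangent_intercept hX h_exp h_span
    (Real.log_neg one_half_pos one_half_lt_one)
  obtain ⟨b, hb, hb'⟩ := exists_tangent_intercept_lt hX h_exp h_end
  have hcont : ContinuousOn (fun t => cumulant μ X t - t * deriv (cumulant μ X) t) (Set.Ioi 0) :=
    fun t ht => (hasDerivAt_tangent_intercept h_exp ht).continuousAt.continuousWithinAt
  obtain ⟨γ, hγ, hγ'⟩ := isPreconnected_Ioi.intermediate_value₂ (Set.mem_Ioi.mpr hb)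
    (Set.mem_Ioi.mpr ha) hcont (continuousOn_const (c := Real.log (1 / 2))) hb'.le ha'.le
  exact ⟨γ, ⟨hγ, hγ'⟩, fun t ht => hanti.injOn ht.1 hγ (ht.2.trans hγ'.symm)⟩

end UpperEndpoint

/-! ### Span one and a Gaussian bound for the characteristic function -/

section CharacteristicFunction

variable {Ω : Type*} [MeasurableSpace Ω] {ν : Measure Ω} {X : Ω → ℤ}

/-- The integers `m` with `exp (i s m) = 1`. -/
def expKernel (s : ℝ) : AddSubgroup ℤ where
  carrier := {m | Complex.exp (s * m * Complex.I) = 1}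
  zero_mem' := by simp
  add_mem' {a b} ha hb := by
    simp only [Set.mem_ofPred_eq] at ha hb ⊢
    have : (s * ((a + b : ℤ) : ℂ) * Complex.I) = s * a * Complex.I + s * b * Complex.I := by
      push_cast; ring
    rw [this, Complex.exp_add, ha, hb, one_mul]
  neg_mem' {a} ha := by
    simp only [Set.mem_ofPred_eq] at ha ⊢
    have : (s * ((-a : ℤ) : ℂ) * Complex.I) = -(s * a * Complex.I) := by
      push_cast; ring
    rw [this, Complex.exp_neg, ha, inv_one]

theorem mem_expKernel {s : ℝ} {m : ℤ} :
    m ∈ expKernel s ↔ Complex.exp (s * m * Complex.I) = 1 := Iff.rfl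

theorem one_notMem_expKernel {s : ℝ} (hs : s ≠ 0) (hs' : |s| ≤ Real.pi) : 1 ∉ expKernel s := by
  rw [mem_expKernel, Complex.exp_eq_one_iff]
  rintro ⟨n, hn⟩
  have h1 : (s : ℂ) = ((n * (2 * Real.pi) : ℝ) : ℂ) := by
    apply mul_right_cancel₀ Complex.I_ne_zero
    push_cast at hn ⊢
    rw [mul_one] at hn
    rw [hn]; ring
  have h2 : s = n * (2 * Real.pi) := by exact_mod_cast h1
  have hn0 : n ≠ 0 := by
    rintro rfl
    exact hs (by simpa using h2)
  have h3 : (1 : ℝ) ≤ |(n : ℝ)| := by exact_mod_cast Int.one_le_abs hn0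
  rw [h2, abs_mul, abs_of_pos Real.two_pi_pos] at hs'
  nlinarith [Real.pi_pos]

/-- Subgroups of ℤ are cyclic: a zero generator makes X constant, a unit generator puts 1 in H, and
any other gives a forbidden progression. -/
theorem HasSpanOne.not_ae_sub_mem (h_span : HasSpanOne ν X) {b : ℤ} {H : AddSubgroup ℤ}
    (hH : 1 ∉ H) : ¬ ∀ᵐ w ∂ν, X w - b ∈ H := by
  intro h
  obtain ⟨a, rfl⟩ := Int.subgroup_cyclic H
  simp only [← AddSubgroup.zmultiples_eq_closure, Int.mem_zmultiples_iff] at h hH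
  rcases Nat.lt_or_ge a.natAbs 2 with ha | ha
  · interval_cases h' : a.natAbs
    · rw [Int.natAbs_eq_zero] at h'
      subst h'
      exact h_span.not_ae_eq b (h.mono fun w hw => by simpa [sub_eq_zero] using hw)
    · exact hH (Int.isUnit_iff_natAbs_eq.mpr h' |>.dvd)
  · exact h_span a.natAbs ha b (h.mono fun w hw => Int.natAbs_dvd.mpr hw)

/-- Equality in the triangle inequality would make e^{isX} almost surely constant, so that X minus
one of its values would lie in `expKernel s`, a proper subgroup. -/
theorem HasSpanOne.norm_integral_exp_lt_one [IsProbabilityMeasure ν]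
    (h_span : HasSpanOne ν X) {s : ℝ} (hs : s ≠ 0) (hs' : |s| ≤ Real.pi) :
    ‖∫ w, Complex.exp (s * X w * Complex.I) ∂ν‖ < 1 := by
  have hnorm : ∀ m : ℤ, ‖Complex.exp (s * m * Complex.I)‖ = 1 := fun m => by
    have : (s * m * Complex.I : ℂ) = ((s * m : ℝ) : ℂ) * Complex.I := by push_cast; ring
    rw [this, Complex.norm_exp_ofReal_mul_I]
  rcases ae_eq_const_or_norm_integral_lt_of_norm_le_const (μ := ν)
    (f := fun w => Complex.exp (s * X w * Complex.I)) (C := 1)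
    (Eventually.of_forall fun w => (hnorm (X w)).le) with h | h
  · exfalso
    obtain ⟨w₀, hw₀⟩ := h.exists
    refine h_span.not_ae_sub_mem (b := X w₀) (one_notMem_expKernel hs hs')
      (h.mono fun w hw => ?_)
    have h1 : Complex.exp (s * X w * Complex.I) = Complex.exp (s * X w₀ * Complex.I) :=
      hw.trans hw₀.symm
    rw [mem_expKernel]
    have : (s * ((X w - X w₀ : ℤ) : ℂ) * Complex.I) =
        s * X w * Complex.I - s * X w₀ * Complex.I := by push_cast; ring
    rw [this, Complex.exp_sub, h1, div_self (Complex.exp_ne_zero _)]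
  · simpa using h

/-- The characteristic function of the normalised variable `(X - ρ) / σ`. -/
noncomputable def normCharFun (ν : Measure Ω) (X : Ω → ℤ) (ρ σ t : ℝ) : ℂ :=
  charFun (ν.map fun w => ((X w : ℝ) - ρ) / σ) t

theorem normCharFun_mul (hX : Measurable X) {ρ σ : ℝ} (hσ : σ ≠ 0) (t : ℝ) :
    normCharFun ν X ρ σ (σ * t) =
      Complex.exp (-(t * ρ * Complex.I)) * ∫ w, Complex.exp (t * X w * Complex.I) ∂ν := by
  rw [normCharFun, charFun_apply_real, integral_map (by fun_prop) (by fun_prop),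
    ← integral_const_mul]
  refine integral_congr_ae (Eventually.of_forall fun w => ?_)
  simp only [← Complex.exp_add]
  congr 1
  have : (σ : ℂ) ≠ 0 := by exact_mod_cast hσ
  push_cast
  field_simp
  ring

theorem continuous_normCharFun [IsFiniteMeasure ν] (ρ σ : ℝ) :
    Continuous (normCharFun ν X ρ σ) := continuous_charFun

theorem norm_normCharFun_lt_one [IsProbabilityMeasure ν] (hX : Measurable X)
    (h_span : HasSpanOne ν X) {ρ σ : ℝ} (hσ : 0 < σ) {t : ℝ} (ht : t ≠ 0)
    (ht' : |t| ≤ Real.pi * σ) : ‖normCharFun ν X ρ σ t‖ < 1 := by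
  have h1 : t = σ * (t / σ) := by field_simp
  have h2 : ‖Complex.exp (-(((t / σ : ℝ) : ℂ) * ρ * Complex.I))‖ = 1 := by
    have : (-(((t / σ : ℝ) : ℂ) * ρ * Complex.I)) = ((-(t / σ * ρ) : ℝ) : ℂ) * Complex.I := by
      push_cast; ring
    rw [this, Complex.norm_exp_ofReal_mul_I]
  rw [h1, normCharFun_mul hX hσ.ne', norm_mul, h2, one_mul]
  refine h_span.norm_integral_exp_lt_one (div_ne_zero ht hσ.ne') ?_
  rw [abs_div, abs_of_pos hσ, div_le_iff₀ hσ]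
  exact ht'

variable {ρ σ : ℝ}

theorem integral_normalised_sq (hX : Measurable X) (hσ : 0 < σ)
    (hρ : ∫ w, (X w : ℝ) ∂ν = ρ) (hvar : Var[fun w => (X w : ℝ); ν] = σ ^ 2) :
    ∫ w, ((fun w => ((X w : ℝ) - ρ) / σ) ^ 2) w ∂ν = 1 := by
  simp only [Pi.pow_apply, div_pow]
  rw [integral_div, ← hρ, ← variance_eq_integral (by fun_prop), hvar, div_self (by positivity)]

variable [IsProbabilityMeasure ν]

theorem integral_normalised (hL2 : MemLp (fun w => (X w : ℝ)) 2 ν)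
    (hρ : ∫ w, (X w : ℝ) ∂ν = ρ) : ∫ w, ((X w : ℝ) - ρ) / σ ∂ν = 0 := by
  rw [integral_div, integral_sub (hL2.integrable (by norm_num)) (integrable_const _), hρ]
  simp

theorem tendsto_normCharFun_pow (hX : Measurable X) (hL2 : MemLp (fun w => (X w : ℝ)) 2 ν)
    (hσ : 0 < σ) (hρ : ∫ w, (X w : ℝ) ∂ν = ρ) (hvar : Var[fun w => (X w : ℝ); ν] = σ ^ 2)
    (t : ℝ) :
    Tendsto (fun n : ℕ => normCharFun ν X ρ σ ((√n)⁻¹ * t) ^ n) atTop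
      (𝓝 (Complex.exp (-t ^ 2 / 2))) :=
  tendsto_charFun_inv_sqrt_mul_pow (by fun_prop) (integral_normalised hL2 hρ)
    (integral_normalised_sq hX hσ hρ hvar) t

/-- Near 0 the second-order Taylor expansion gives the bound; on the rest of the window compactness
and strict inequality keep the norm below some η < 1. Both regimes lie under 1 - ct² ≤ e^{-ct²}. -/
theorem exists_norm_normCharFun_le (hX : Measurable X) (h_span : HasSpanOne ν X)
    (hL2 : MemLp (fun w => (X w : ℝ)) 2 ν) (hσ : 0 < σ) (hρ : ∫ w, (X w : ℝ) ∂ν = ρ)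
    (hvar : Var[fun w => (X w : ℝ); ν] = σ ^ 2) :
    ∃ c, 0 < c ∧ ∀ t, |t| ≤ Real.pi * σ → ‖normCharFun ν X ρ σ t‖ ≤ Real.exp (-c * t ^ 2) := by
  have hR : 0 < Real.pi * σ := mul_pos Real.pi_pos hσ
  have htaylor := taylor_charFun_two (X := fun w => ((X w : ℝ) - ρ) / σ) (P := ν) (by fun_prop)
    (integral_normalised hL2 hρ) (integral_normalised_sq hX hσ hρ hvar)
  -- A remainder of at most t²/4 uses up half of the quadratic term t²/2.
  obtain ⟨r, hr, hball⟩ := Metric.eventually_nhds_iff.mp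
    (htaylor.bound (show (0 : ℝ) < 1 / 4 by norm_num))
  have hnear : ∀ t, |t| < min r 1 → ‖normCharFun ν X ρ σ t‖ ≤ 1 - t ^ 2 / 4 := fun t ht => by
    have h1 := hball (y := t) (by simpa using ht.trans_le (min_le_left _ _))
    have h2 : |t| < 1 := ht.trans_le (min_le_right _ _)
    have h3 : t ^ 2 ≤ 1 := by
      rw [← sq_abs]; nlinarith [abs_nonneg t]
    have h4 : ‖(1 - (t : ℂ) ^ 2 / 2)‖ = 1 - t ^ 2 / 2 := by
      have : (1 - (t : ℂ) ^ 2 / 2) = ((1 - t ^ 2 / 2 : ℝ) : ℂ) := by push_cast; ring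
      rw [this, Complex.norm_real, Real.norm_of_nonneg (by linarith)]
    have h5 : ‖normCharFun ν X ρ σ t‖ ≤
        ‖normCharFun ν X ρ σ t - (1 - (t : ℂ) ^ 2 / 2)‖ + ‖(1 - (t : ℂ) ^ 2 / 2)‖ := by
      have := norm_add_le (normCharFun ν X ρ σ t - (1 - (t : ℂ) ^ 2 / 2)) (1 - (t : ℂ) ^ 2 / 2)
      rwa [sub_add_cancel] at this
    rw [Real.norm_of_nonneg (sq_nonneg t)] at h1
    have h6 : ‖normCharFun ν X ρ σ t - (1 - (t : ℂ) ^ 2 / 2)‖ ≤ 1 / 4 * t ^ 2 := h1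
    linarith
  obtain ⟨η, hη, hfar⟩ : ∃ η < 1, ∀ t, min r 1 ≤ |t| → |t| ≤ Real.pi * σ →
      ‖normCharFun ν X ρ σ t‖ ≤ η := by
    have hK : IsCompact {t : ℝ | min r 1 ≤ |t| ∧ |t| ≤ Real.pi * σ} := by
      refine (isCompact_Icc (a := -(Real.pi * σ)) (b := Real.pi * σ)).of_isClosed_subset ?_
        fun t ht => abs_le.mp ht.2
      exact (isClosed_le continuous_const continuous_abs).inter
        (isClosed_le continuous_abs continuous_const)
    rcases Set.eq_empty_or_nonempty {t : ℝ | min r 1 ≤ |t| ∧ |t| ≤ Real.pi * σ} with he | hne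
    · exact ⟨0, one_pos, fun t h1 h2 =>
        (Set.eq_empty_iff_forall_notMem.mp he t ⟨h1, h2⟩).elim⟩
    · obtain ⟨s, hs, hmax⟩ := hK.exists_isMaxOn hne
        (continuous_normCharFun (ν := ν) (X := X) ρ σ).norm.continuousOn
      have hs0 : s ≠ 0 := by
        rintro rfl
        have := hs.1
        rw [abs_zero] at this
        exact absurd this (not_le.mpr (lt_min hr one_pos))
      exact ⟨_, norm_normCharFun_lt_one hX h_span hσ hs0 hs.2, fun t h1 h2 => hmax ⟨h1, h2⟩⟩
  -- This c satisfies ct² ≤ t²/4, and ct² ≤ 1 - η as long as |t| ≤ πσ.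
  refine ⟨min (1 / 4) ((1 - η) / (Real.pi * σ) ^ 2),
    lt_min (by norm_num) (div_pos (by linarith) (by positivity)), fun t ht => ?_⟩
  have hexp := Real.add_one_le_exp (-min (1 / 4) ((1 - η) / (Real.pi * σ) ^ 2) * t ^ 2)
  refine le_trans ?_ hexp
  rcases lt_or_ge |t| (min r 1) with h | h
  · have := mul_le_mul_of_nonneg_right (min_le_left (1 / 4) ((1 - η) / (Real.pi * σ) ^ 2))
      (sq_nonneg t)
    linarith [hnear t h]
  · have h1 := mul_le_mul_of_nonneg_right (min_le_right (1 / 4) ((1 - η) / (Real.pi * σ) ^ 2))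
      (sq_nonneg t)
    have h2 : (1 - η) / (Real.pi * σ) ^ 2 * t ^ 2 ≤ 1 - η := by
      rw [div_mul_eq_mul_div, div_le_iff₀ (by positivity)]
      refine mul_le_mul_of_nonneg_left ?_ (by linarith)
      rw [← sq_abs t]
      exact pow_le_pow_left₀ (abs_nonneg t) ht 2
    linarith [hfar t h ht]

end CharacteristicFunction

/-! ### Fourier inversion for tails of integer-valued variables -/

section Inversion

open Complex in
theorem integral_exp_mul_int (γ : ℝ) (j : ℤ) :
    ∫ t in -Real.pi..Real.pi, Complex.exp ((γ + t * Complex.I) * j) =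
      if j = 0 then (2 * Real.pi : ℂ) else 0 := by
  split_ifs with h
  · subst h
    simp only [Int.cast_zero, mul_zero, Complex.exp_zero, intervalIntegral.integral_const,
      sub_neg_eq_add]
    rw [← two_mul, real_smul]
    push_cast; ring
  · have hj : (j : ℂ) * I ≠ 0 := mul_ne_zero (by exact_mod_cast h) I_ne_zero
    have h1 : ∀ t : ℝ, exp ((γ + t * I) * j) = exp (γ * j) * exp (j * I * t) := fun t => by
      rw [← exp_add]; congr 1; ring
    simp_rw [h1]
    rw [intervalIntegral.integral_const_mul, integral_exp_mul_complex hj]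
    have h2 : exp (j * I * Real.pi) = exp (j * I * ((-Real.pi : ℝ) : ℂ)) :=
      exp_eq_exp_iff_exists_int.mpr ⟨j, by push_cast; ring⟩
    rw [h2, sub_self, zero_div, mul_zero]

theorem norm_exp_add_mul_I_mul (γ t x : ℝ) :
    ‖Complex.exp ((γ + t * Complex.I) * x)‖ = Real.exp (γ * x) := by
  rw [Complex.norm_exp]
  simp

theorem norm_exp_neg_add_mul_I (γ t : ℝ) :
    ‖Complex.exp (-(γ + t * Complex.I))‖ = Real.exp (-γ) := by
  rw [Complex.norm_exp]
  simp

theorem one_sub_exp_neg_le_norm (γ t : ℝ) :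
    1 - Real.exp (-γ) ≤ ‖1 - Complex.exp (-(γ + t * Complex.I))‖ := by
  rw [← norm_exp_neg_add_mul_I γ t]
  simpa using norm_sub_norm_le 1 (Complex.exp (-(γ + t * Complex.I)))

theorem one_sub_exp_neg_pos {γ : ℝ} (hγ : 0 < γ) : 0 < 1 - Real.exp (-γ) := by
  have : Real.exp (-γ) < 1 := Real.exp_lt_one_iff.mpr (by linarith)
  linarith

theorem one_sub_exp_ne_zero {γ : ℝ} (hγ : 0 < γ) (t : ℝ) :
    1 - Complex.exp (-(γ + t * Complex.I)) ≠ 0 :=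
  norm_pos_iff.mp ((one_sub_exp_neg_pos hγ).trans_le (one_sub_exp_neg_le_norm γ t))

/-- Fourier inversion for the indicator of the nonnegative integers. -/
theorem integral_exp_mul_int_div {γ : ℝ} (hγ : 0 < γ) (m : ℤ) :
    ∫ t in -Real.pi..Real.pi, Complex.exp ((γ + t * Complex.I) * m) /
      (1 - Complex.exp (-(γ + t * Complex.I))) = if 0 ≤ m then (2 * Real.pi : ℂ) else 0 := by
  have hterm : ∀ (t : ℝ) (i : ℕ), Complex.exp ((γ + t * Complex.I) * m) *
      Complex.exp (-(γ + t * Complex.I)) ^ i =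
        Complex.exp ((γ + t * Complex.I) * ((m - i : ℤ) : ℂ)) := fun t i => by
    rw [← Complex.exp_nat_mul, ← Complex.exp_add]
    congr 1; push_cast; ring
  have hlt : Real.exp (-γ) < 1 := Real.exp_lt_one_iff.mpr (by linarith)
  have hsummable : Summable fun i : ℕ => Real.exp (γ * m) * Real.exp (-γ) ^ i :=
    (summable_geometric_of_lt_one (Real.exp_pos _).le hlt).mul_left _
  -- Since γ > 0, the geometric series in e^{-(γ+it)} is dominated uniformly in t. After termwise
  -- integration only i = m survives, and such an index exists exactly when m ≥ 0.
  have hsum : HasSum (fun i : ℕ => ∫ t in -Real.pi..Real.pi,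
      Complex.exp ((γ + t * Complex.I) * ((m - i : ℤ) : ℂ)))
      (∫ t in -Real.pi..Real.pi, Complex.exp ((γ + t * Complex.I) * m) /
        (1 - Complex.exp (-(γ + t * Complex.I)))) := by
    refine intervalIntegral.hasSum_integral_of_dominated_convergence
      (fun i _ => Real.exp (γ * m) * Real.exp (-γ) ^ i) ?_ ?_ ?_ ?_ ?_
    · intro i
      exact Continuous.aestronglyMeasurable (by fun_prop)
    · intro i
      refine Eventually.of_forall fun t _ => ?_
      have h := norm_exp_add_mul_I_mul γ t m
      rw [Complex.ofReal_intCast] at h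
      rw [← hterm, norm_mul, norm_pow, norm_exp_neg_add_mul_I, h]
    · exact Eventually.of_forall fun t _ => hsummable
    · exact intervalIntegrable_const
    · refine Eventually.of_forall fun t _ => ?_
      have hgeom : HasSum (fun i : ℕ => Complex.exp (-(γ + t * Complex.I)) ^ i)
          (1 - Complex.exp (-(γ + t * Complex.I)))⁻¹ :=
        hasSum_geometric_of_norm_lt_one (by rw [norm_exp_neg_add_mul_I]; exact hlt)
      have hmul := hgeom.mul_left (Complex.exp ((γ + t * Complex.I) * m))
      rw [← div_eq_mul_inv] at hmul
      exact hmul.congr_fun fun i => (hterm t i).symm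
  simp_rw [integral_exp_mul_int] at hsum
  refine hsum.unique ?_
  split_ifs with hm
  · obtain ⟨k, rfl⟩ := Int.eq_ofNat_of_zero_le hm
    convert hasSum_ite_eq k (2 * Real.pi : ℂ) using 3
    omega
  · have : (fun i : ℕ => if m - i = 0 then (2 * Real.pi : ℂ) else 0) = fun _ => 0 := by
      funext i
      rw [if_neg (by omega)]
    rw [this]
    exact hasSum_zero

variable {Ω : Type*} [MeasurableSpace Ω] {μ : Measure Ω}

theorem measurable_partialSum {ξ : ℕ → Ω → ℤ} (hξ : ∀ i, Measurable (ξ i)) (n : ℕ) :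
    Measurable (partialSum ξ n) := by
  unfold partialSum
  fun_prop

theorem integral_cexp_partialSum {ξ : ℕ → Ω → ℤ} (hξ : ∀ i, Measurable (ξ i))
    (hξ_indep : iIndepFun ξ μ) (hξ_ident : ∀ i, IdentDistrib (ξ i) (ξ 0) μ μ) (n : ℕ) (z : ℂ) :
    ∫ w, Complex.exp (z * (partialSum ξ n w : ℂ)) ∂μ =
      (∫ w, Complex.exp (z * (ξ 0 w : ℂ)) ∂μ) ^ n := by
  have h := (hξ_indep.precomp (g := fun i : Fin n => (i : ℕ)) Fin.val_injective).integral_fun_prod_comp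
    (f := fun _ (m : ℤ) => Complex.exp (z * (m : ℂ))) (fun i => (hξ i).aemeasurable)
    (fun i => measurable_from_top.aestronglyMeasurable)
  have h1 : ∀ w, Complex.exp (z * (partialSum ξ n w : ℂ)) =
      ∏ i : Fin n, Complex.exp (z * (ξ i w : ℂ)) := fun w => by
    rw [← Complex.exp_sum, ← Finset.mul_sum, partialSum, Finset.sum_range]
    push_cast; rfl
  simp_rw [h1]
  refine h.trans ?_
  have h2 : ∀ i : Fin n, ∫ w, Complex.exp (z * (ξ i w : ℂ)) ∂μ =
      ∫ w, Complex.exp (z * (ξ 0 w : ℂ)) ∂μ := fun i =>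
    ((hξ_ident i).comp (u := fun m : ℤ => Complex.exp (z * (m : ℂ)))
      measurable_from_top).integral_eq
  rw [Finset.prod_congr rfl fun i _ => h2 i, Finset.prod_const, Finset.card_univ, Fintype.card_fin]

variable [IsProbabilityMeasure μ]

/-- Fourier inversion for the tail of an integer-valued random variable. -/
theorem measure_ge_eq_integral {Y : Ω → ℤ} (hY : Measurable Y) {γ : ℝ} (hγ : 0 < γ)
    (h_exp : Integrable (fun w => Real.exp (γ * (Y w : ℝ))) μ) (k : ℤ) :
    ((2 * Real.pi * μ.real {w | k ≤ Y w} : ℝ) : ℂ) =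
      ∫ t in -Real.pi..Real.pi, (∫ w, Complex.exp ((γ + t * Complex.I) * ((Y w - k : ℤ) : ℂ)) ∂μ) /
        (1 - Complex.exp (-(γ + t * Complex.I))) := by
  have hpi : -Real.pi ≤ Real.pi := by linarith [Real.pi_pos]
  have hmeas : MeasurableSet {w | k ≤ Y w} := measurableSet_le measurable_const hY
  rw [intervalIntegral.integral_of_le hpi]
  simp_rw [← integral_div]
  rw [integral_integral_swap]
  · simp_rw [← intervalIntegral.integral_of_le hpi, integral_exp_mul_int_div hγ]
    have : (fun w => if 0 ≤ Y w - k then (2 * Real.pi : ℂ) else 0) =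
        {w | k ≤ Y w}.indicator fun _ => (2 * Real.pi : ℂ) := by
      funext w
      simp [Set.indicator_apply]
    rw [this, integral_indicator_const _ hmeas, Complex.real_smul]
    push_cast; ring
  · have hbound : Integrable (fun w => Real.exp (-(γ * k)) / (1 - Real.exp (-γ)) *
        Real.exp (γ * (Y w : ℝ))) μ := h_exp.const_mul _
    refine (hbound.comp_snd (volume.restrict (Set.Ioc (-Real.pi) Real.pi))).mono' ?_ ?_
    · refine Measurable.aestronglyMeasurable ?_
      have h1 : Measurable fun p : ℝ × Ω => ((Y p.2 - k : ℤ) : ℂ) :=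
        (measurable_from_top (f := fun j : ℤ => ((j - k : ℤ) : ℂ))).comp (hY.comp measurable_snd)
      unfold Function.uncurry
      fun_prop
    · refine Eventually.of_forall fun p => ?_
      have h := norm_exp_add_mul_I_mul γ p.1 ((Y p.2 - k : ℤ) : ℝ)
      rw [Complex.ofReal_intCast] at h
      simp only [Function.uncurry]
      rw [norm_div, h]
      have h2 : Real.exp (γ * ((Y p.2 - k : ℤ) : ℝ)) =
          Real.exp (-(γ * k)) * Real.exp (γ * (Y p.2 : ℝ)) := by
        rw [← Real.exp_add]; congr 1; push_cast; ring
      rw [h2, div_mul_eq_mul_div]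
      exact div_le_div_of_nonneg_left (by positivity) (one_sub_exp_neg_pos hγ)
        (one_sub_exp_neg_le_norm γ p.1)

theorem integrable_exp_partialSum {ξ : ℕ → Ω → ℤ} (hξ : ∀ i, Measurable (ξ i))
    (hξ_indep : iIndepFun ξ μ) (hξ_ident : ∀ i, IdentDistrib (ξ i) (ξ 0) μ μ) {γ : ℝ}
    (h_exp : Integrable (fun w => Real.exp (γ * (ξ 0 w : ℝ))) μ) (n : ℕ) :
    Integrable (fun w => Real.exp (γ * (partialSum ξ n w : ℝ))) μ := by
  have hind : iIndepFun (fun i w => (ξ i w : ℝ)) μ :=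
    hξ_indep.comp (fun _ m => (m : ℝ)) fun _ => measurable_from_top
  have h := hind.integrable_exp_mul_sum (t := γ) (fun i => by fun_prop) (s := Finset.range n)
    fun i _ => ((hξ_ident i).comp (u := fun m : ℤ => Real.exp (γ * (m : ℝ)))
      measurable_from_top).integrable_iff.mpr h_exp
  refine h.congr (Eventually.of_forall fun w => ?_)
  simp [partialSum]

/-- Change of measure: the real part γ of the exponent becomes the density of the tilted law, at the
cost of the factor e^{L(γ)}; only the oscillating part remains. -/
theorem integral_cexp_eq_normCharFun {X : Ω → ℤ} (hX : Measurable X) {γ ρ σ : ℝ} (hσ : σ ≠ 0)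
    (h_exp : Integrable (fun w => Real.exp (γ * (X w : ℝ))) μ) (t : ℝ) :
    ∫ w, Complex.exp ((γ + t * Complex.I) * (X w : ℂ)) ∂μ =
      Real.exp (cumulant μ X γ) * (Complex.exp (t * ρ * Complex.I) *
        normCharFun (μ.tilted fun w => γ * (X w : ℝ)) X ρ σ (σ * t)) := by
  have h1 : Real.exp (cumulant μ X γ) = mgf (fun w => (X w : ℝ)) μ γ := exp_cgf h_exp
  have hpos : mgf (fun w => (X w : ℝ)) μ γ ≠ 0 := (mgf_pos h_exp).ne'
  rw [normCharFun_mul hX hσ, ← mul_assoc (Complex.exp _) (Complex.exp _), ← Complex.exp_add,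
    add_neg_cancel, Complex.exp_zero, one_mul, integral_tilted_mul_eq_mgf, h1,
    ← integral_const_mul]
  refine integral_congr_ae (Eventually.of_forall fun w => ?_)
  have hpos' : (mgf (fun w => (X w : ℝ)) μ γ : ℂ) ≠ 0 := by exact_mod_cast hpos
  simp only [Complex.real_smul]
  push_cast
  rw [← mul_assoc, mul_div_cancel₀ _ hpos', ← Complex.exp_add]
  congr 1; ring

end Inversion

/-! ### Asymptotics of the Fourier integral on the scale 1/√n -/

section LocalLimit

theorem tendsto_sqrt_natCast {ι : Type*} {l : Filter ι} {N : ι → ℕ} (hN : Tendsto N l atTop) :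
    Tendsto (fun i => √(N i : ℝ)) l atTop :=
  Real.tendsto_sqrt_atTop.comp (tendsto_natCast_atTop_atTop.comp hN)

/-- The Fourier integrand on the scale of the central limit theorem. -/
noncomputable def rescaledIntegrand (χ : ℝ → ℂ) (γ σ : ℝ) (n : ℕ) (u s : ℝ) : ℂ :=
  χ ((√n)⁻¹ * s) ^ n * Complex.exp (-(((σ * √n)⁻¹ * s * u : ℝ) * Complex.I)) /
    (1 - Complex.exp (-(γ + ((σ * √n)⁻¹ * s : ℝ) * Complex.I)))

theorem sqrt_mul_integral_eq (χ : ℝ → ℂ) (γ : ℝ) {σ : ℝ} (hσ : 0 < σ) {n : ℕ} (hn : 0 < n)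
    (u : ℝ) :
    (√n : ℂ) * ∫ t in -Real.pi..Real.pi, χ (σ * t) ^ n * Complex.exp (-((t * u : ℝ) * Complex.I)) /
      (1 - Complex.exp (-(γ + t * Complex.I))) =
    (σ : ℂ)⁻¹ * ∫ s, (Set.Ioc (-(σ * √n * Real.pi)) (σ * √n * Real.pi)).indicator
      (rescaledIntegrand χ γ σ n u) s := by
  have hsqrt : 0 < √(n : ℝ) := Real.sqrt_pos.mpr (by exact_mod_cast hn)
  have hle : -(σ * √n * Real.pi) ≤ σ * √n * Real.pi := by
    have : 0 ≤ σ * √n * Real.pi := by positivity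
    linarith
  rw [integral_indicator measurableSet_Ioc, ← intervalIntegral.integral_of_le hle,
    ← mul_neg, ← intervalIntegral.smul_integral_comp_mul_left, Complex.real_smul]
  have h1 : ∀ t : ℝ, rescaledIntegrand χ γ σ n u (σ * √n * t) =
      χ (σ * t) ^ n * Complex.exp (-((t * u : ℝ) * Complex.I)) /
        (1 - Complex.exp (-(γ + t * Complex.I))) := fun t => by
    have h2 : (√n)⁻¹ * (σ * √n * t) = σ * t := by field_simp
    have h3 : (σ * √n)⁻¹ * (σ * √n * t) = t := by field_simp
    rw [rescaledIntegrand, h2, h3]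
  simp_rw [h1]
  have hσ' : (σ : ℂ) ≠ 0 := by exact_mod_cast hσ.ne'
  rw [← mul_assoc]
  congr 1
  push_cast
  field_simp

variable {χ : ℝ → ℂ} {γ σ c : ℝ}

/-- The indicator confines s/√n to the window of the Gaussian bound, and the n-th power turns
e^{-cs²/n} into e^{-cs²}: a majorant free of n and u. -/
theorem norm_rescaledIntegrand_le (hγ : 0 < γ)
    (hbound : ∀ t, |t| ≤ Real.pi * σ → ‖χ t‖ ≤ Real.exp (-c * t ^ 2)) {n : ℕ} (hn : 0 < n)
    (u s : ℝ) :
    ‖(Set.Ioc (-(σ * √n * Real.pi)) (σ * √n * Real.pi)).indicator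
      (rescaledIntegrand χ γ σ n u) s‖ ≤ Real.exp (-c * s ^ 2) / (1 - Real.exp (-γ)) := by
  have hpos := one_sub_exp_neg_pos hγ
  have hn' : 0 < (n : ℝ) := by exact_mod_cast hn
  have hsqrt : 0 < √(n : ℝ) := Real.sqrt_pos.mpr hn'
  by_cases hs : s ∈ Set.Ioc (-(σ * √n * Real.pi)) (σ * √n * Real.pi)
  · rw [Set.indicator_of_mem hs, rescaledIntegrand, norm_div, norm_mul, norm_pow]
    have h1 : ‖Complex.exp (-(((σ * √n)⁻¹ * s * u : ℝ) * Complex.I))‖ = 1 := by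
      rw [← neg_mul, ← Complex.ofReal_neg, Complex.norm_exp_ofReal_mul_I]
    rw [h1, mul_one]
    refine div_le_div₀ (Real.exp_pos _).le ?_ hpos (one_sub_exp_neg_le_norm γ _)
    have h2 : |(√n)⁻¹ * s| ≤ Real.pi * σ := by
      rw [abs_mul, abs_of_pos (inv_pos.mpr hsqrt), inv_mul_le_iff₀ hsqrt]
      refine (abs_le.mpr ⟨hs.1.le, hs.2⟩).trans (le_of_eq (by ring))
    calc ‖χ ((√n)⁻¹ * s)‖ ^ n ≤ Real.exp (-c * ((√n)⁻¹ * s) ^ 2) ^ n :=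
          pow_le_pow_left₀ (norm_nonneg _) (hbound _ h2) n
      _ = Real.exp (-c * s ^ 2) := by
          rw [← Real.exp_nat_mul, mul_pow, inv_pow, Real.sq_sqrt hn'.le]
          congr 1
          field_simp
  · rw [Set.indicator_of_notMem hs, norm_zero]
    positivity

/-- Dominated convergence: the phase vanishes because u = o(√N), and the denominator tends to 1 -
e^{-γ}. A general filter is allowed so that uniformity in z can be encoded in it. -/
theorem tendsto_sqrt_mul_integral (hχ : Continuous χ) (hγ : 0 < γ) (hσ : 0 < σ) (hc : 0 < c)
    (hbound : ∀ t, |t| ≤ Real.pi * σ → ‖χ t‖ ≤ Real.exp (-c * t ^ 2))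
    (hlim : ∀ t : ℝ, Tendsto (fun n : ℕ => χ ((√n)⁻¹ * t) ^ n) atTop
      (𝓝 (Complex.exp (-t ^ 2 / 2))))
    {ι : Type*} {l : Filter ι} [l.IsCountablyGenerated] {N : ι → ℕ} (hN : Tendsto N l atTop)
    {u : ι → ℝ} (hu : Tendsto (fun i => u i / √(N i)) l (𝓝 0)) :
    Tendsto (fun i => (√(N i) : ℂ) * ∫ t in -Real.pi..Real.pi,
      χ (σ * t) ^ N i * Complex.exp (-((t * u i : ℝ) * Complex.I)) /
        (1 - Complex.exp (-(γ + t * Complex.I)))) l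
      (𝓝 ((√(2 * Real.pi) / (σ * (1 - Real.exp (-γ))) : ℝ) : ℂ)) := by
  have hNpos : ∀ᶠ i in l, 0 < N i := hN.eventually_gt_atTop 0
  have hpos := one_sub_exp_neg_pos hγ
  have hsqrt := tendsto_sqrt_natCast hN
  have hgauss : ∫ s : ℝ, Complex.exp (-s ^ 2 / 2) / (1 - Complex.exp (-γ)) =
      ((√(2 * Real.pi) / (1 - Real.exp (-γ)) : ℝ) : ℂ) := by
    rw [integral_div]
    have h := integral_gaussian (1 / 2)
    have h1 : ∀ s : ℝ, Complex.exp (-s ^ 2 / 2) = ((Real.exp (-(1 / 2) * s ^ 2) : ℝ) : ℂ) :=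
      fun s => by push_cast; congr 1; ring
    simp_rw [h1]
    rw [integral_complex_ofReal, h]
    have h2 : Real.pi / (1 / 2) = 2 * Real.pi := by ring
    rw [h2]
    push_cast; rfl
  have hmain : Tendsto (fun i => ∫ s, (Set.Ioc (-(σ * √(N i) * Real.pi))
      (σ * √(N i) * Real.pi)).indicator (rescaledIntegrand χ γ σ (N i) (u i)) s) l
      (𝓝 (∫ s : ℝ, Complex.exp (-s ^ 2 / 2) / (1 - Complex.exp (-γ)))) := by
    refine tendsto_integral_filter_of_dominated_convergence
      (fun s => Real.exp (-c * s ^ 2) / (1 - Real.exp (-γ))) ?_ ?_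
      ((integrable_exp_neg_mul_sq hc).div_const _) ?_
    · refine Eventually.of_forall fun i => ?_
      refine AEStronglyMeasurable.indicator (Measurable.aestronglyMeasurable ?_) measurableSet_Ioc
      unfold rescaledIntegrand
      have := hχ.measurable
      fun_prop
    · filter_upwards [hNpos] with i hi
      exact Eventually.of_forall fun s => norm_rescaledIntegrand_le hγ hbound hi _ s
    · refine Eventually.of_forall fun s => ?_
      have hmem : ∀ᶠ i in l, s ∈ Set.Ioc (-(σ * √(N i) * Real.pi)) (σ * √(N i) * Real.pi) := by
        have : Tendsto (fun i => σ * √(N i) * Real.pi) l atTop :=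
          (hsqrt.const_mul_atTop hσ).atTop_mul_const Real.pi_pos
        filter_upwards [this.eventually_gt_atTop |s|] with i hi
        exact ⟨(abs_lt.mp hi).1, (abs_lt.mp hi).2.le⟩
      have hx : Tendsto (fun i => (σ * √(N i))⁻¹ * s) l (𝓝 0) := by
        have := (tendsto_inv_atTop_zero.comp (hsqrt.const_mul_atTop hσ)).mul_const s
        rwa [zero_mul] at this
      have hy : Tendsto (fun i => (σ * √(N i))⁻¹ * s * u i) l (𝓝 0) := by
        have := hu.const_mul (σ⁻¹ * s)
        rw [mul_zero] at this
        refine this.congr fun i => ?_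
        rw [mul_inv, div_eq_mul_inv]; ring
      have h1 : Tendsto (fun i => Complex.exp (-(((σ * √(N i))⁻¹ * s * u i : ℝ) * Complex.I))) l
          (𝓝 1) := by
        have hcont : Continuous fun y : ℝ => Complex.exp (-((y : ℂ) * Complex.I)) := by fun_prop
        exact (hcont.tendsto' 0 1 (by simp)).comp hy
      have h2 : Tendsto (fun i => 1 - Complex.exp (-(γ + ((σ * √(N i))⁻¹ * s : ℝ) * Complex.I))) l
          (𝓝 (1 - Complex.exp (-γ))) := by
        have hcont : Continuous fun y : ℝ => 1 - Complex.exp (-(γ + (y : ℂ) * Complex.I)) := by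
          fun_prop
        exact (hcont.tendsto' 0 (1 - Complex.exp (-γ)) (by simp)).comp hx
      have hne : 1 - Complex.exp (-(γ : ℂ)) ≠ 0 := by
        simpa using one_sub_exp_ne_zero hγ 0
      have h3 := ((((hlim s).comp hN).mul h1).div h2 hne)
      rw [mul_one] at h3
      refine h3.congr' ?_
      filter_upwards [hmem] with i hi
      rw [Set.indicator_of_mem hi]
      rfl
  rw [hgauss] at hmain
  have hval : ((√(2 * Real.pi) / (σ * (1 - Real.exp (-γ))) : ℝ) : ℂ) =
      (σ : ℂ)⁻¹ * ((√(2 * Real.pi) / (1 - Real.exp (-γ)) : ℝ) : ℂ) := by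
    rw [← Complex.ofReal_inv, ← Complex.ofReal_mul]
    congr 1
    field_simp
  rw [hval]
  refine (hmain.const_mul _).congr' ?_
  filter_upwards [hNpos] with i hi
  exact (sqrt_mul_integral_eq χ γ hσ hi (u i)).symm

end LocalLimit

/-! ### Precise large deviations of the partial sums -/

section TailAsymptotics

variable {Ω : Type*} [MeasurableSpace Ω] {μ : Measure Ω} {ξ : ℕ → Ω → ℤ}

theorem HasSpanOne.tilted {X : Ω → ℤ} (h_span : HasSpanOne μ X) {γ : ℝ}
    (h_exp : Integrable (fun w => Real.exp (γ * (X w : ℝ))) μ) :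
    HasSpanOne (μ.tilted fun w => γ * (X w : ℝ)) X := fun d hd b h =>
  h_span d hd b ((absolutelyContinuous_tilted h_exp).ae_le h)

variable [IsProbabilityMeasure μ]

theorem measure_ge_partialSum_eq (hξ : ∀ i, Measurable (ξ i)) (hξ_indep : iIndepFun ξ μ)
    (hξ_ident : ∀ i, IdentDistrib (ξ i) (ξ 0) μ μ) {γ ρ σ : ℝ} (hγ : 0 < γ) (hσ : σ ≠ 0)
    (h_exp : Integrable (fun w => Real.exp (γ * (ξ 0 w : ℝ))) μ) (n : ℕ) (k : ℤ) :
    ((2 * Real.pi * μ.real {w | k ≤ partialSum ξ n w} : ℝ) : ℂ) =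
      (Real.exp (n * cumulant μ (ξ 0) γ - γ * k) : ℝ) * ∫ t in -Real.pi..Real.pi,
        normCharFun (μ.tilted fun w => γ * (ξ 0 w : ℝ)) (ξ 0) ρ σ (σ * t) ^ n *
          Complex.exp (-((t * (k - ρ * n) : ℝ) * Complex.I)) /
          (1 - Complex.exp (-(γ + t * Complex.I))) := by
  rw [measure_ge_eq_integral (measurable_partialSum hξ n) hγ
    (integrable_exp_partialSum hξ hξ_indep hξ_ident h_exp n) k,
    ← intervalIntegral.integral_const_mul]
  refine intervalIntegral.integral_congr fun t _ => ?_
  have h1 : ∀ w, Complex.exp ((γ + t * Complex.I) * ((partialSum ξ n w - k : ℤ) : ℂ)) =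
      Complex.exp (-((γ + t * Complex.I) * k)) *
        Complex.exp ((γ + t * Complex.I) * (partialSum ξ n w : ℂ)) := fun w => by
    rw [← Complex.exp_add]; congr 1; push_cast; ring
  simp only [h1]
  rw [integral_const_mul, integral_cexp_partialSum hξ hξ_indep hξ_ident,
    integral_cexp_eq_normCharFun (ρ := ρ) (hξ 0) hσ h_exp, mul_pow, mul_pow, ← mul_div_assoc]
  congr 1
  rw [← Complex.exp_nat_mul, Complex.ofReal_exp, ← Complex.exp_nat_mul, Complex.ofReal_exp,
    ← mul_assoc, ← mul_assoc, ← Complex.exp_add, ← Complex.exp_add]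
  rw [mul_comm (normCharFun _ _ _ _ _ ^ n) (Complex.exp _),
    ← mul_assoc (Complex.exp _) (Complex.exp _), ← Complex.exp_add]
  congr 2
  push_cast; ring

/-- Precise large deviations at the critical level, uniformly on bounded sets of `z`. -/
theorem eventually_measure_ge_partialSum (hξ : ∀ i, Measurable (ξ i)) (hξ_indep : iIndepFun ξ μ)
    (hξ_ident : ∀ i, IdentDistrib (ξ i) (ξ 0) μ μ)
    (h_exp : ∀ γ : ℝ, 0 < γ → Integrable (fun w => Real.exp (γ * (ξ 0 w : ℝ))) μ)
    (h_span : HasSpanOne μ (ξ 0)) {γ ρ σ : ℝ} (hγ : IsCriticalExponent μ (ξ 0) γ)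
    (hρ : ρ = deriv (cumulant μ (ξ 0)) γ) (hσ : 0 < σ)
    (hvar : iteratedDeriv 2 (cumulant μ (ξ 0)) γ = σ ^ 2)
    {I : Set ℝ} (hI : Bornology.IsBounded I) {δ : ℝ} (hδ : 0 < δ) :
    ∀ᶠ n : ℕ in atTop, ∀ z ∈ I, ∀ k : ℤ, ρ * n - Real.log n / (2 * γ) + z = k →
      |2 ^ n * μ.real {w | k ≤ partialSum ξ n w} * Real.exp (γ * z) *
        (√(2 * Real.pi) * σ * (1 - Real.exp (-γ))) - 1| ≤ δ := by
  obtain ⟨hγ0, hcrit⟩ := hγ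
  have hmem := mem_interior_integrableExpSet h_exp hγ0
  have : IsProbabilityMeasure (μ.tilted fun w => γ * (ξ 0 w : ℝ)) :=
    isProbabilityMeasure_tilted (h_exp γ hγ0)
  have hL2 : MemLp (fun w => (ξ 0 w : ℝ)) 2 (μ.tilted fun w => γ * (ξ 0 w : ℝ)) :=
    memLp_tilted_mul hmem 2
  have hmean : ∫ w, (ξ 0 w : ℝ) ∂(μ.tilted fun w => γ * (ξ 0 w : ℝ)) = ρ := by
    rw [hρ]; exact integral_tilted_mul_self hmem
  have hvar' : Var[fun w => (ξ 0 w : ℝ); μ.tilted fun w => γ * (ξ 0 w : ℝ)] = σ ^ 2 := by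
    rw [← hvar]; exact variance_tilted_mul hmem
  have hspan' := h_span.tilted (h_exp γ hγ0)
  obtain ⟨c, hc, hbound⟩ := exists_norm_normCharFun_le (hξ 0) hspan' hL2 hσ hmean hvar'
  obtain ⟨B, hB⟩ := hI.exists_norm_le
  have hpos := one_sub_exp_neg_pos hγ0
  -- Convergence along `atTop ×ˢ 𝓟 I` is convergence in n uniformly over z in I.
  have hsnd : ∀ᶠ p : ℕ × ℝ in atTop ×ˢ 𝓟 I, p.2 ∈ I :=
    tendsto_snd.eventually (eventually_mem_principal I)
  have hu : Tendsto (fun p : ℕ × ℝ => (p.2 - Real.log p.1 / (2 * γ)) / √(p.1 : ℝ))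
      (atTop ×ˢ 𝓟 I) (𝓝 0) := by
    have h1 : Tendsto (fun p : ℕ × ℝ => p.2 / √(p.1 : ℝ)) (atTop ×ˢ 𝓟 I) (𝓝 0) := by
      have h2 : Tendsto (fun p : ℕ × ℝ => B / √(p.1 : ℝ)) (atTop ×ˢ 𝓟 I) (𝓝 0) :=
        tendsto_const_nhds.div_atTop (tendsto_sqrt_natCast tendsto_fst)
      refine squeeze_zero_norm' ?_ h2
      filter_upwards [hsnd] with p hp
      rw [norm_div, Real.norm_of_nonneg (Real.sqrt_nonneg _)]
      exact div_le_div_of_nonneg_right (hB _ hp) (Real.sqrt_nonneg _)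
    have h3 : Tendsto (fun p : ℕ × ℝ => Real.log p.1 / √(p.1 : ℝ)) (atTop ×ˢ 𝓟 I) (𝓝 0) := by
      have h4 := (isLittleO_log_rpow_atTop (one_half_pos (α := ℝ))).tendsto_div_nhds_zero
      simp_rw [← Real.sqrt_eq_rpow] at h4
      exact h4.comp (tendsto_natCast_atTop_atTop.comp tendsto_fst)
    have h5 := h1.sub (h3.div_const (2 * γ))
    rw [zero_div, sub_zero] at h5
    refine h5.congr fun p => ?_
    rw [sub_div, div_right_comm]
  have hlim := tendsto_sqrt_mul_integral (continuous_normCharFun ρ σ) hγ0 hσ hc hbound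
    (tendsto_normCharFun_pow (hξ 0) hL2 hσ hmean hvar') (l := atTop ×ˢ 𝓟 I)
    (N := Prod.fst) tendsto_fst hu
  have hClim := (hlim.mul_const
    (((√(2 * Real.pi) * σ * (1 - Real.exp (-γ))) / (2 * Real.pi) : ℝ) : ℂ))
  rw [← Complex.ofReal_mul] at hClim
  have hone : √(2 * Real.pi) / (σ * (1 - Real.exp (-γ))) *
      (√(2 * Real.pi) * σ * (1 - Real.exp (-γ)) / (2 * Real.pi)) = 1 := by
    have h2 := Real.mul_self_sqrt Real.two_pi_pos.le
    have h3 := Real.pi_pos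
    field_simp
    rw [sq, h2]
  rw [hone, Complex.ofReal_one] at hClim
  have hev := (Metric.tendsto_nhds.mp hClim) δ hδ
  rw [eventually_prod_principal_iff] at hev
  filter_upwards [hev, eventually_gt_atTop 0] with n hn hn0 z hz k hk
  have hdist := hn z hz
  have hn0' : (0 : ℝ) < n := by exact_mod_cast hn0
  have hfourier := measure_ge_partialSum_eq (ρ := ρ) hξ hξ_indep hξ_ident hγ0 hσ.ne'
    (h_exp γ hγ0) n k
  have hkz : (k : ℝ) - ρ * n = z - Real.log n / (2 * γ) := by rw [← hk]; ring
  -- Here the critical equation enters: n(L(γ) - γρ) = -n ln 2, while the logarithmic shift of the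
  -- level contributes √n, the factor that normalises the integral.
  have hexp : Real.exp (n * cumulant μ (ξ 0) γ - γ * k) =
      (2 ^ n)⁻¹ * √n * Real.exp (-(γ * z)) := by
    have h1 : Real.exp (n * Real.log (1 / 2)) = (2 ^ n)⁻¹ := by
      rw [Real.exp_nat_mul, Real.exp_log one_half_pos, one_div, inv_pow]
    have h2 : √(n : ℝ) = Real.exp (Real.log n / 2) := by
      rw [← Real.log_sqrt hn0'.le, Real.exp_log (Real.sqrt_pos.mpr hn0')]
    rw [← h1, h2, ← Real.exp_add, ← Real.exp_add, ← hk, ← hcrit, ← hρ]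
    congr 1
    field_simp
    ring
  rw [hkz, hexp] at hfourier
  rw [dist_eq_norm] at hdist
  refine le_of_eq_of_le ?_ hdist.le
  rw [← Real.norm_eq_abs, ← Complex.norm_real]
  congr 1
  rw [Complex.ofReal_sub, Complex.ofReal_one]
  congr 1
  have h3 : (2 ^ n * μ.real {w | k ≤ partialSum ξ n w} * Real.exp (γ * z) *
      (√(2 * Real.pi) * σ * (1 - Real.exp (-γ)))) =
      (2 * Real.pi * μ.real {w | k ≤ partialSum ξ n w}) * (2 ^ n * Real.exp (γ * z) *
        ((√(2 * Real.pi) * σ * (1 - Real.exp (-γ))) / (2 * Real.pi))) := by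
    have h3 := Real.pi_pos
    field_simp
  rw [h3, Complex.ofReal_mul, hfourier]
  have h4 : ((2 ^ n)⁻¹ * √n * Real.exp (-(γ * z))) * (2 ^ n * Real.exp (γ * z)) = √(n : ℝ) := by
    have h5 : Real.exp (-(γ * z)) * Real.exp (γ * z) = 1 := by
      rw [← Real.exp_add, neg_add_cancel, Real.exp_zero]
    calc _ = ((2 ^ n)⁻¹ * 2 ^ n) * √(n : ℝ) * (Real.exp (-(γ * z)) * Real.exp (γ * z)) := by ring
      _ = _ := by rw [h5, inv_mul_cancel₀ (by positivity)]; ring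
  conv_rhs => rw [← h4]
  simp only [Complex.ofReal_mul]
  ring

end TailAsymptotics

/-! ### From the tail of one sum to the maximum of 2^n copies -/

section Maximum

theorem maxCopies_lt_iff {Ω : Type*} {n : ℕ} {S : Fin (2 ^ n) → Ω → ℤ} {w : Ω} {k : ℤ} :
    maxCopies S w < k ↔ ∀ j, S j w < k := by
  simp [maxCopies]

theorem measureReal_maxCopies_lt {Ω : Type*} [MeasurableSpace Ω] {μ : Measure Ω}
    [IsProbabilityMeasure μ] {n : ℕ} {S : Fin (2 ^ n) → Ω → ℤ} {Y : Ω → ℤ} (hY : Measurable Y)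
    (hS_indep : iIndepFun S μ) (hS_ident : ∀ j, IdentDistrib (S j) Y μ μ) (k : ℤ) :
    μ.real {w | maxCopies S w < k} = (1 - μ.real {w | k ≤ Y w}) ^ (2 ^ n) := by
  have hset : {w | maxCopies S w < k} = ⋂ j, {w | S j w < k} := by
    ext w
    simp [maxCopies_lt_iff]
  have hprod : μ {w | maxCopies S w < k} = ∏ j, μ {w | S j w < k} := by
    rw [hset]
    exact hS_indep.meas_iInter fun j => ⟨Set.Iio k, measurableSet_Iio, rfl⟩
  have hj : ∀ j, μ {w | S j w < k} = μ {w | Y w < k} := fun j =>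
    (hS_ident j).measure_mem_eq measurableSet_Iio
  have hcompl : {w | k ≤ Y w} = {w | Y w < k}ᶜ := by
    ext w
    simp
  rw [hcompl, probReal_compl_eq_one_sub (measurableSet_lt hY measurable_const), Measure.real,
    hprod, Finset.prod_congr rfl fun j _ => hj j, Finset.prod_const, Finset.card_univ,
    Fintype.card_fin, ENNReal.toReal_pow, sub_sub_cancel]
  rfl

/-- For p ≤ 1/2, p ≤ -ln(1 - p) ≤ p(1 + 2p). The relative error is then at most δ/2 + (Np/x)·2p, and
Np/x ≤ 2 with p ≤ δ/8 bounds the second term by δ/2. -/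
theorem exists_one_sub_pow_eq_exp {N : ℕ} {p x δ : ℝ} (hx : 0 < x) (hp : 0 ≤ p)
    (hp2 : p ≤ 1 / 2) (hpδ : p ≤ δ / 8) (h1 : |N * p / x - 1| ≤ 1) (h2 : |N * p / x - 1| ≤ δ / 2) :
    ∃ e, |e| ≤ δ ∧ (1 - p) ^ N = Real.exp (-(x * (1 + e))) := by
  have hlt : 0 < 1 - p := by linarith
  refine ⟨N * -Real.log (1 - p) / x - 1, ?_, ?_⟩
  · have hlow : p ≤ -Real.log (1 - p) := by
      have := Real.log_le_sub_one_of_pos hlt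
      linarith
    have hupp : -Real.log (1 - p) ≤ p * (1 + 2 * p) := by
      have := Real.one_sub_inv_le_log_of_pos hlt
      have h3 : (1 - p)⁻¹ ≤ 1 + p * (1 + 2 * p) := by
        rw [inv_le_iff_one_le_mul₀ hlt]
        nlinarith [mul_nonneg hp (mul_nonneg hp (by linarith : 0 ≤ 1 - 2 * p))]
      linarith
    have hN : 0 ≤ (N : ℝ) / x := by positivity
    have h4 := mul_le_mul_of_nonneg_left hlow hN
    have h5 := mul_le_mul_of_nonneg_left hupp hN
    rw [abs_le] at *
    have e1 : (N : ℝ) / x * p = N * p / x := by ring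
    have e2 : (N : ℝ) / x * -Real.log (1 - p) = N * -Real.log (1 - p) / x := by ring
    have e3 : (N : ℝ) / x * (p * (1 + 2 * p)) = N * p / x + (N * p / x) * (2 * p) := by ring
    rw [e1, e2] at h4
    rw [e2, e3] at h5
    constructor
    · linarith
    · nlinarith
  · have h3 : x * (1 + (N * -Real.log (1 - p) / x - 1)) = N * -Real.log (1 - p) := by
      field_simp
      ring
    rw [h3, mul_neg, neg_neg, Real.exp_nat_mul, Real.exp_log hlt]

variable {Ω : Type*} [MeasurableSpace Ω] {μ : Measure Ω} [IsProbabilityMeasure μ] {ξ : ℕ → Ω → ℤ}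

theorem eventually_measureReal_maxCopies_lt (hξ : ∀ i, Measurable (ξ i))
    (hξ_indep : iIndepFun ξ μ) (hξ_ident : ∀ i, IdentDistrib (ξ i) (ξ 0) μ μ)
    (h_exp : ∀ γ : ℝ, 0 < γ → Integrable (fun w => Real.exp (γ * (ξ 0 w : ℝ))) μ)
    (h_span : HasSpanOne μ (ξ 0)) {S : (n : ℕ) → Fin (2 ^ n) → Ω → ℤ}
    (hS_indep : ∀ n, iIndepFun (S n) μ)
    (hS_ident : ∀ n j, IdentDistrib (S n j) (partialSum ξ n) μ μ)
    {γ ρ σ : ℝ} (hγ : IsCriticalExponent μ (ξ 0) γ)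
    (hρ : ρ = deriv (cumulant μ (ξ 0)) γ) (hσ : 0 < σ)
    (hvar : iteratedDeriv 2 (cumulant μ (ξ 0)) γ = σ ^ 2)
    {I : Set ℝ} (hI : Bornology.IsBounded I) {δ : ℝ} (hδ : 0 < δ) :
    ∀ᶠ n : ℕ in atTop, ∀ z ∈ I, ∀ k : ℤ, ρ * n - Real.log n / (2 * γ) + z = k →
      ∃ e : ℝ, |e| ≤ δ ∧ μ.real {w | maxCopies (S n) w < k} =
        Real.exp (-(Real.exp (-γ * z) * (1 + e) /
          (√(2 * Real.pi) * σ * (1 - Real.exp (-γ))))) := by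
  have hγ0 := hγ.1
  have hC : 0 < √(2 * Real.pi) * σ * (1 - Real.exp (-γ)) :=
    mul_pos (mul_pos (Real.sqrt_pos.mpr Real.two_pi_pos) hσ) (one_sub_exp_neg_pos hγ0)
  set C := √(2 * Real.pi) * σ * (1 - Real.exp (-γ)) with hCdef
  obtain ⟨B, hB⟩ := hI.exists_norm_le
  have htail := eventually_measure_ge_partialSum hξ hξ_indep hξ_ident h_exp h_span hγ hρ hσ hvar
    hI (lt_min one_pos (half_pos hδ))
  -- A majorant of p over z in I: relative error at most 1 gives 2^n p ≤ 2e^{-γz}/C, and z ≥ -B.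
  have hsmall : Tendsto (fun n : ℕ => 2 * (Real.exp (γ * B) / C) / (2 : ℝ) ^ n) atTop (𝓝 0) :=
    tendsto_const_nhds.div_atTop (tendsto_pow_atTop_atTop_of_one_lt one_lt_two)
  have hsmall' := hsmall.eventually_le_const
    (lt_min (one_half_pos (α := ℝ)) (by positivity : 0 < δ / 8))
  filter_upwards [htail, hsmall'] with n hn hns z hz k hk
  have h := hn z hz k hk
  set p := μ.real {w | k ≤ partialSum ξ n w} with hp
  have hx : 0 < Real.exp (-γ * z) / C := by positivity
  have hexp : Real.exp (-γ * z) = (Real.exp (γ * z))⁻¹ := by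
    rw [← Real.exp_neg]; congr 1; ring
  have hratio : ((2 ^ n : ℕ) : ℝ) * p / (Real.exp (-γ * z) / C) =
      2 ^ n * p * Real.exp (γ * z) * C := by
    rw [hexp]
    push_cast
    field_simp
  rw [← hCdef, ← hratio] at h
  have hp_small : p ≤ 2 * (Real.exp (γ * B) / C) / 2 ^ n := by
    have h1 := (abs_le.mp (h.trans (min_le_left _ _))).2
    have h2 : ((2 ^ n : ℕ) : ℝ) * p / (Real.exp (-γ * z) / C) ≤ 2 := by linarith
    rw [div_le_iff₀ hx] at h2
    have h3 : Real.exp (-γ * z) ≤ Real.exp (γ * B) := by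
      rw [Real.exp_le_exp]
      have := (abs_le.mp (hB z hz)).1
      nlinarith
    have h4 : Real.exp (-γ * z) / C ≤ Real.exp (γ * B) / C :=
      div_le_div_of_nonneg_right h3 hC.le
    rw [le_div_iff₀ (by positivity)]
    push_cast at h2
    linarith
  have hp_le := hp_small.trans hns
  obtain ⟨e, he, hpow⟩ := exists_one_sub_pow_eq_exp hx measureReal_nonneg
    (hp_le.trans (min_le_left _ _)) (hp_le.trans (min_le_right _ _))
    (h.trans (min_le_left _ _)) (h.trans (min_le_right _ _))
  refine ⟨e, he, ?_⟩
  rw [measureReal_maxCopies_lt (measurable_partialSum hξ n) (hS_indep n) (hS_ident n), hpow]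
  congr 2
  ring

end Maximum

/-! ### Uniform approximation by the discrete Gumbel law -/

section Helix

theorem measureReal_helix_Iio {γ : ℝ} (hγ : 0 < γ) (a : ℝ) (m : ℤ) :
    (helix γ a).real (Set.Iio m) = gumbelCDF γ a m := by
  rw [measureReal_def, helix_Iio hγ]
  exact ENNReal.toReal_ofReal (Real.exp_pos _).le

/-- Splitting √n off the logarithm in a_n recovers the level ρn - ln n/(2γ); what is left of the
shift becomes the constant in the denominator. -/
theorem gumbelCDF_critical {γ ρ σ : ℝ} (hγ : 0 < γ) (hσ : 0 < σ) {n : ℕ} (hn : 0 < n) (m : ℤ) :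
    gumbelCDF γ (ρ * n - Real.log (√(2 * Real.pi * n) * σ * (1 - Real.exp (-γ))) / γ) m =
      Real.exp (-(Real.exp (-γ * (m - (ρ * n - Real.log n / (2 * γ)))) /
        (√(2 * Real.pi) * σ * (1 - Real.exp (-γ))))) := by
  have hn' : 0 < (n : ℝ) := by exact_mod_cast hn
  have hC : 0 < √(2 * Real.pi) * σ * (1 - Real.exp (-γ)) :=
    mul_pos (mul_pos (Real.sqrt_pos.mpr Real.two_pi_pos) hσ) (one_sub_exp_neg_pos hγ)
  have h1 : √(2 * Real.pi * n) * σ * (1 - Real.exp (-γ)) =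
      √(2 * Real.pi) * σ * (1 - Real.exp (-γ)) * √n := by
    rw [Real.sqrt_mul Real.two_pi_pos.le]; ring
  rw [gumbelCDF, h1, Real.log_mul hC.ne' (Real.sqrt_pos.mpr hn').ne', Real.log_sqrt hn'.le]
  congr 2
  rw [eq_div_iff hC.ne']
  nth_rewrite 2 [← Real.exp_log hC]
  rw [← Real.exp_add]
  congr 1
  field_simp
  ring

theorem abs_exp_neg_sub_exp_neg_le {a b : ℝ} (ha : 0 ≤ a) (hb : 0 ≤ b) :
    |Real.exp (-a) - Real.exp (-b)| ≤ |a - b| := by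
  wlog h : a ≤ b generalizing a b
  · rw [abs_sub_comm, abs_sub_comm a]
    exact this hb ha (le_of_not_ge h)
  have h1 := Real.add_one_le_exp (-(b - a))
  have h2 : Real.exp (-b) = Real.exp (-a) * Real.exp (-(b - a)) := by
    rw [← Real.exp_add]; congr 1; ring
  have h3 : Real.exp (-a) ≤ 1 := Real.exp_le_one_iff.mpr (by linarith)
  have h4 : Real.exp (-(b - a)) ≤ 1 := Real.exp_le_one_iff.mpr (by linarith)
  rw [h2, abs_of_nonneg (by nlinarith [Real.exp_pos (-a)]), abs_of_nonpos (by linarith)]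
  nlinarith [Real.exp_pos (-a)]

/-- Two distribution functions on the integers which are uniformly close near the bulk `b + [-Z, Z]`
of the second one are uniformly close everywhere. -/
theorem abs_sub_le_of_close_on_bulk {F : ℤ → ℝ} {G : ℝ → ℝ} {b Z δ : ℝ} (hF : Monotone F)
    (hF0 : ∀ m, 0 ≤ F m) (hF1 : ∀ m, F m ≤ 1) (hG0 : ∀ z, 0 ≤ G z) (hG1 : ∀ z, G z ≤ 1)
    (hhigh : ∀ z, Z ≤ z → 1 - δ / 2 ≤ G z) (hlow : ∀ z, z ≤ -Z → G z ≤ δ / 2) (hZ : 0 ≤ Z)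
    (hclose : ∀ m : ℤ, |m - b| ≤ Z + 1 → |F m - G (m - b)| ≤ δ / 2) (m : ℤ) :
    |F m - G (m - b)| ≤ δ := by
  have hδ : 0 ≤ δ := by
    have := (hG0 (-Z)).trans (hlow (-Z) le_rfl)
    linarith
  rcases le_or_gt |m - b| (Z + 1) with h | h
  · linarith [hclose m h]
  rcases lt_abs.mp h with h | h
  · have h1 := Int.le_ceil (b + Z)
    have h2 := Int.ceil_lt_add_one (b + Z)
    have h3 : ⌈b + Z⌉ ≤ m := Int.ceil_le.mpr (by linarith)
    have h4 := hclose ⌈b + Z⌉ (abs_le.mpr ⟨by linarith, by linarith⟩)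
    have h5 := hhigh (⌈b + Z⌉ - b) (by linarith)
    have h6 := hhigh (m - b) (by linarith)
    have h7 := hF h3
    rw [abs_le] at h4 ⊢
    constructor <;> linarith [hF1 m, hG1 (m - b)]
  · have h1 := Int.floor_le (b - Z)
    have h2 := Int.lt_floor_add_one (b - Z)
    have h3 : m ≤ ⌊b - Z⌋ := Int.le_floor.mpr (by linarith)
    have h4 := hclose ⌊b - Z⌋ (abs_le.mpr ⟨by linarith, by linarith⟩)
    have h5 := hlow (⌊b - Z⌋ - b) (by linarith)
    have h6 := hlow (m - b) (by linarith)
    have h7 := hF h3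
    rw [abs_le] at h4 ⊢
    constructor <;> linarith [hF0 m, hG0 (m - b)]

theorem exists_gumbel_bulk {γ C δ : ℝ} (hγ : 0 < γ) (hC : 0 < C) (hδ : 0 < δ) :
    ∃ Z, 0 ≤ Z ∧ (∀ z, Z ≤ z → 1 - δ ≤ Real.exp (-(Real.exp (-γ * z) / C))) ∧
      ∀ z, z ≤ -Z → Real.exp (-(Real.exp (-γ * z) / C)) ≤ δ := by
  have hhigh : Tendsto (fun z : ℝ => Real.exp (-(Real.exp (-γ * z) / C))) atTop (𝓝 1) := by
    have h1 : Tendsto (fun z : ℝ => -γ * z) atTop atBot :=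
      tendsto_id.const_mul_atTop_of_neg (by linarith)
    have h2 := ((Real.tendsto_exp_atBot.comp h1).div_const C).neg
    rw [zero_div, neg_zero] at h2
    have := (Real.continuous_exp.tendsto 0).comp h2
    rwa [Real.exp_zero] at this
  have hlow : Tendsto (fun z : ℝ => Real.exp (-(Real.exp (-γ * z) / C))) atBot (𝓝 0) := by
    have h1 : Tendsto (fun z : ℝ => -γ * z) atBot atTop :=
      tendsto_id.const_mul_atBot_of_neg (by linarith)
    exact Real.tendsto_exp_atBot.comp (tendsto_neg_atTop_atBot.comp
      ((Real.tendsto_exp_atTop.comp h1).atTop_div_const hC))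
  obtain ⟨a, ha⟩ := eventually_atTop.mp (hhigh.eventually_const_le (by linarith : 1 - δ < 1))
  obtain ⟨b, hb⟩ := eventually_atBot.mp (hlow.eventually_le_const hδ)
  refine ⟨max 0 (max a (-b)), le_max_left _ _, fun z hz => ha z ?_, fun z hz => hb z ?_⟩
  · exact (le_max_left a (-b)).trans ((le_max_right _ _).trans hz)
  · have := (le_max_right a (-b)).trans (le_max_right 0 _)
    linarith

theorem eventually_abs_measureReal_sub_helix_le {Ω : Type*} [MeasurableSpace Ω] {μ : Measure Ω}
    [IsProbabilityMeasure μ] {S : (n : ℕ) → Fin (2 ^ n) → Ω → ℤ} {γ ρ σ : ℝ} (hγ : 0 < γ)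
    (hσ : 0 < σ)
    (hlim : ∀ I : Set ℝ, Bornology.IsBounded I → ∀ δ : ℝ, 0 < δ → ∀ᶠ n : ℕ in atTop,
      ∀ z ∈ I, ∀ k : ℤ, ρ * n - Real.log n / (2 * γ) + z = k →
        ∃ e : ℝ, |e| ≤ δ ∧ μ.real {w | maxCopies (S n) w < k} =
          Real.exp (-(Real.exp (-γ * z) * (1 + e) /
            (√(2 * Real.pi) * σ * (1 - Real.exp (-γ))))))
    {δ : ℝ} (hδ : 0 < δ) :
    ∀ᶠ n : ℕ in atTop, ∀ m : ℤ, |μ.real {w | maxCopies (S n) w < m} -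
      (helix γ (ρ * n - Real.log (√(2 * Real.pi * n) * σ * (1 - Real.exp (-γ))) / γ)).real
        (Set.Iio m)| ≤ δ := by
  have hC : 0 < √(2 * Real.pi) * σ * (1 - Real.exp (-γ)) :=
    mul_pos (mul_pos (Real.sqrt_pos.mpr Real.two_pi_pos) hσ) (one_sub_exp_neg_pos hγ)
  obtain ⟨Z, hZ, hhigh, hlow⟩ := exists_gumbel_bulk hγ hC (half_pos hδ)
  -- This quantity K bounds e^{-γz}/C for |z| ≤ Z + 1, where C is its denominator. A relative error
  -- δ/(2K) thus costs at most δ/2, as e^{-x} is 1-Lipschitz on x ≥ 0; the cap at 1 keeps 1 + e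
  -- nonnegative.
  have hK : 0 < Real.exp (γ * (Z + 1)) / (√(2 * Real.pi) * σ * (1 - Real.exp (-γ))) := by
    positivity
  have hev := hlim _ (Metric.isBounded_Icc (-(Z + 1)) (Z + 1)) _
    (lt_min one_pos (div_pos (half_pos hδ) hK))
  filter_upwards [hev, eventually_gt_atTop 0] with n hn hn0 m
  rw [measureReal_helix_Iio hγ, gumbelCDF_critical hγ hσ hn0]
  refine abs_sub_le_of_close_on_bulk (F := fun m => μ.real {w | maxCopies (S n) w < m})
    (G := fun z => Real.exp (-(Real.exp (-γ * z) / (√(2 * Real.pi) * σ * (1 - Real.exp (-γ))))))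
    ?_ (fun _ => measureReal_nonneg) (fun _ => measureReal_le_one) (fun _ => (Real.exp_pos _).le)
    (fun _ => Real.exp_le_one_iff.mpr (by rw [neg_nonpos]; positivity)) hhigh hlow hZ ?_ m
  · intro k l hkl
    exact measureReal_mono fun w (hw : maxCopies (S n) w < k) => lt_of_lt_of_le hw hkl
  · intro k hk
    obtain ⟨e, he, heq⟩ := hn (k - (ρ * n - Real.log n / (2 * γ))) (abs_le.mp hk) k (by ring)
    have he1 := abs_le.mp (he.trans (min_le_left _ _))
    have he2 := he.trans (min_le_right _ _)
    rw [le_div_iff₀ hK] at he2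
    simp only [heq]
    refine (abs_exp_neg_sub_exp_neg_le ?_ (by positivity)).trans (le_trans ?_ he2)
    · exact div_nonneg (mul_nonneg (Real.exp_pos _).le (by linarith)) hC.le
    · rw [← sub_div, mul_add, mul_one, add_sub_cancel_left, mul_comm (Real.exp _) e, mul_div_assoc,
        abs_mul, abs_of_pos (by positivity : 0 < Real.exp
          (-γ * (k - (ρ * n - Real.log n / (2 * γ)))) /
            (√(2 * Real.pi) * σ * (1 - Real.exp (-γ))))]
      refine mul_le_mul_of_nonneg_left (div_le_div_of_nonneg_right ?_ hC.le) (abs_nonneg e)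
      rw [Real.exp_le_exp]
      nlinarith [(abs_le.mp hk).1]

end Helix

end CyclicMaxima

/-- Integer-valued i.i.d. variables `ξ 0, ξ 1, …` with `E|ξ 0| < ∞`, finite positive exponential
moments and maximal span one, such that the upper endpoint is infinite, or finite and attained
with probability less than `1/2`; for each `n`, `S n` is a family of `2 ^ n` independent copies of
the `n`-th partial sum. -/
theorem theorem1 {Ω : Type*} [MeasurableSpace Ω] (μ : Measure Ω) [IsProbabilityMeasure μ]
    (ξ : ℕ → Ω → ℤ)
    (hξ_meas : ∀ i, Measurable (ξ i))
    (hξ_indep : iIndepFun ξ μ)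
    (hξ_ident : ∀ i, IdentDistrib (ξ i) (ξ 0) μ μ)
    (h_int : Integrable (fun w => (ξ 0 w : ℝ)) μ)
    (h_exp : ∀ γ : ℝ, 0 < γ → Integrable (fun w => Real.exp (γ * (ξ 0 w : ℝ))) μ)
    (h_span : CyclicMaxima.HasSpanOne μ (ξ 0))
    (h_end : CyclicMaxima.upperEndpoint μ (ξ 0) = ⊤ ∨
      (CyclicMaxima.upperEndpoint μ (ξ 0) < ⊤ ∧
        μ {w | ((ξ 0 w : ℝ) : EReal) = CyclicMaxima.upperEndpoint μ (ξ 0)} < 1 / 2))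
    (S : (n : ℕ) → Fin (2 ^ n) → Ω → ℤ)
    (hS_indep : ∀ n, iIndepFun (S n) μ)
    (hS_ident : ∀ n j, IdentDistrib (S n j) (CyclicMaxima.partialSum ξ n) μ μ) :
    (∃! γ : ℝ, CyclicMaxima.IsCriticalExponent μ (ξ 0) γ) ∧
    ∀ γ ρ σ : ℝ, CyclicMaxima.IsCriticalExponent μ (ξ 0) γ →
      ρ = deriv (CyclicMaxima.cumulant μ (ξ 0)) γ →
      σ = CyclicMaxima.sigma μ (ξ 0) γ →
      0 < σ ∧
      (∀ I : Set ℝ, Bornology.IsBounded I → ∀ δ : ℝ, 0 < δ → ∀ᶠ n : ℕ in atTop,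
        ∀ z ∈ I, (∃ k : ℤ, ρ * n - Real.log n / (2 * γ) + z = k) →
          ∃ e : ℝ, |e| ≤ δ ∧
            μ.real {w | (CyclicMaxima.maxCopies (S n) w : ℝ)
                < ρ * n - Real.log n / (2 * γ) + z} =
              Real.exp (-(Real.exp (-γ * z) * (1 + e) /
                (Real.sqrt (2 * Real.pi) * σ * (1 - Real.exp (-γ)))))) ∧
      (∀ δ : ℝ, 0 < δ → ∀ᶠ n : ℕ in atTop, ∀ m : ℤ,
        |μ.real {w | CyclicMaxima.maxCopies (S n) w < m} -
          (CyclicMaxima.helix γ (ρ * n -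
            Real.log (Real.sqrt (2 * Real.pi * n) * σ * (1 - Real.exp (-γ))) / γ)).real
              (Set.Iio m)| ≤ δ) := by
  refine ⟨CyclicMaxima.existsUnique_isCriticalExponent (hξ_meas 0) h_exp h_span h_end, ?_⟩
  intro γ ρ σ hγ hρ hσ_eq
  have hpos := CyclicMaxima.iteratedDeriv_two_cumulant_pos h_exp h_span hγ.1
  have hσ : 0 < σ := hσ_eq ▸ Real.sqrt_pos.mpr hpos
  have hvar : iteratedDeriv 2 (CyclicMaxima.cumulant μ (ξ 0)) γ = σ ^ 2 := by
    rw [hσ_eq, CyclicMaxima.sigma, Real.sq_sqrt hpos.le]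
  have hlim : ∀ I : Set ℝ, Bornology.IsBounded I → ∀ δ : ℝ, 0 < δ → ∀ᶠ n : ℕ in atTop,
      ∀ z ∈ I, ∀ k : ℤ, ρ * n - Real.log n / (2 * γ) + z = k →
        ∃ e : ℝ, |e| ≤ δ ∧ μ.real {w | CyclicMaxima.maxCopies (S n) w < k} =
          Real.exp (-(Real.exp (-γ * z) * (1 + e) /
            (Real.sqrt (2 * Real.pi) * σ * (1 - Real.exp (-γ))))) := fun I hI δ hδ =>
    CyclicMaxima.eventually_measureReal_maxCopies_lt hξ_meas hξ_indep hξ_ident h_exp h_span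
      hS_indep hS_ident hγ hρ hσ hvar hI hδ
  refine ⟨hσ, fun I hI δ hδ => ?_, fun δ hδ =>
    CyclicMaxima.eventually_abs_measureReal_sub_helix_le hγ.1 hσ hlim hδ⟩
  filter_upwards [hlim I hI δ hδ] with n hn z hz ⟨k, hk⟩
  obtain ⟨e, he, heq⟩ := hn z hz k hk
  refine ⟨e, he, ?_⟩
  rw [← heq, hk]
  simp only [Int.cast_lt]
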